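/- Let $R$ be a Noetherian commutative ring of Krull dimension $\le 4$, and let $P_0$ be a finitely generated projective $R$-module of constant rank $2$ with an isomorphism $\theta_0 : R \to \det(P_0)=\Lambda^2 P_0$. Put $P_5 = P_0 \oplus R^3$. For a finitely generated projective $R$-module $P$ let $Um(P)$ be the set of epimorphisms $P \to R$, on which $Aut(P)$ acts on the right by composition, and let $SL(P) \le Aut(P)$ be the subgroup of automorphisms of determinant $1$. Let $E(P_0\oplus R) \le Aut(P_0 \oplus R)$ be the subgroup generated by the automorphisms $\mathrm{id}+s$ with $s : P_0 \to R$ or $s : R \to P_0$ linear. Let $V_{SL}(R)$ be the quotient of the free abelian group on isometry classes $[P,g,f]$ of triples, where $P$ is a finitely generated projective $R$-module and $g,f$ are non-degenerate alternating forms on $P$ (alternating isomorphisms $P\to P^\vee$), by the relations - $[P\oplus P', g\perp g', f\perp f'] = [P,g,f]+[P',g',f']$, - $[P,f_0,f_1]+[P,f_1,f_2]=[P,f_0,f_2]$, - $[P,g,f]=[P,g,\varphi^\vee f\varphi]$ for $\varphi\in SL(P)$. Let $\psi_2 = \begin{pmatrix}0&1\\-1&0\end{pmatrix}$ and $\psi_{2n}=\psi_2\perp\dots\perp\psi_2$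 ($n$ blocks), and let $\tilde V_{SL}(R)\subseteq V_{SL}(R)$ be the subgroup of all classes $[R^{2n},\psi_{2n},M]$, where $n \ge 0$ and $M$ is an invertible alternating $2n\times 2n$ matrix over $R$ with Pfaffian $1$. Let $\chi_0(p,q)=\theta_0^{-1}(p\wedge q)$ on $P_0$. For $a\in Um(P_0\oplus R)$ with kernel $P(a)$, choose $s\in P_0\oplus R$ with $a(s)=1$, let $i_s : P_0\oplus R\to P(a)\oplus R$ be the isomorphism $x\mapsto (x-a(x)s,\,a(x))$, and let $\chi_a$ be the non-degenerate alternating form on $P(a)$ that sends $(p,q)$ to the image of $p\wedge q\wedge s$ under $\Lambda^3(P_0\oplus R)\cong \Lambda^2P_0\xrightarrow{\theta_0^{-1}}R$, where the first isomorphism is the inverse of $p\wedge q\mapsto p\wedge q\wedge(0,1)$. The generalized Vaserstein symbol of $a$ is $$V(a)=\bigl[P_0\oplus R^2,\ \chi_0\perp\psi_2,\ (i_s\oplus 1)^t(\chi_a\perp\psi_2)(i_s\oplus 1)\bigr];$$ it depends only on the class of $a$ in $Um(P_0\oplus R)/E(P_0\oplus R)$. Assume that $SL(P_5)$ acts transitively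 on $Um(P_5)$. Then $V$ is a surjective map $Um(P_0\oplus R)/E(P_0\oplus R)\to\tilde V_{SL}(R)$; that is, the image of $V$ in $V_{SL}(R)$ is exactly $\tilde V_{SL}(R)$. -/

import Mathlib

open scoped TensorProduct

universe u v w

set_option linter.unusedSectionVars false

noncomputable section

namespace GenVaserstein

/-! ### Alternating isomorphisms -/

/-- An alternating isomorphism on `P` (equivalently a non-degenerate alternating form): a bilinear
form with `form p p = 0` whose associated map `P → Pᵛ`, `p ↦ form p`, is an isomorphism. -/
@[ext]
structure AltIso (R : Type u) [CommRing R] (P : Type v) [AddCommGroup P] [Module R P] where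
  form : P →ₗ[R] P →ₗ[R] R
  alt : ∀ p, form p p = 0
  bij : Function.Bijective form

namespace AltIso

variable {R : Type u} [CommRing R] {P : Type v} [AddCommGroup P] [Module R P]
  {Q : Type w} [AddCommGroup Q] [Module R Q]

/-- `hᵛ f h`, that is, the form `(p, q) ↦ f (h p) (h q)`. -/
def pullback (h : P ≃ₗ[R] Q) (f : AltIso R Q) : AltIso R P where
  form := f.form.compl₁₂ h.toLinearMap h.toLinearMap
  alt p := f.alt (h p)
  bij := by
    constructor
    · intro p q hpq
      apply h.injective
      apply f.bij.1
      ext y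
      have := LinearMap.congr_fun hpq (h.symm y)
      simpa using this
    · intro l
      obtain ⟨y, hy⟩ := f.bij.2 (l ∘ₗ h.symm.toLinearMap)
      refine ⟨h.symm y, ?_⟩
      ext q
      simp [hy]

@[simp]
lemma pullback_apply (h : P ≃ₗ[R] Q) (f : AltIso R Q) (p q : P) :
    (f.pullback h).form p q = f.form (h p) (h q) := rfl

/-- The orthogonal sum `f ⊥ g` on `P ⊕ Q`. -/
def perp (f : AltIso R P) (g : AltIso R Q) : AltIso R (P × Q) where
  form := f.form.compl₁₂ (LinearMap.fst R P Q) (LinearMap.fst R P Q)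
    + g.form.compl₁₂ (LinearMap.snd R P Q) (LinearMap.snd R P Q)
  alt p := by simp [f.alt, g.alt]
  bij := by
    constructor
    · intro x y hxy
      apply Prod.ext
      · apply f.bij.1
        ext q
        simpa using LinearMap.congr_fun hxy (q, 0)
      · apply g.bij.1
        ext q
        simpa using LinearMap.congr_fun hxy (0, q)
    · intro l
      obtain ⟨p, hp⟩ := f.bij.2 (l ∘ₗ LinearMap.inl R P Q)
      obtain ⟨q, hq⟩ := g.bij.2 (l ∘ₗ LinearMap.inr R P Q)
      refine ⟨(p, q), ?_⟩
      apply LinearMap.ext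
      rintro ⟨x, y⟩
      have h : ((x, y) : P × Q) = (x, 0) + (0, y) := by simp
      rw [h, map_add, map_add]
      have h1 := LinearMap.congr_fun hp x
      have h2 := LinearMap.congr_fun hq y
      simp only [LinearMap.comp_apply, LinearMap.inl_apply, LinearMap.inr_apply] at h1 h2
      simp [h1, h2]

@[simp]
lemma perp_apply (f : AltIso R P) (g : AltIso R Q) (x y : P × Q) :
    (f.perp g).form x y = f.form x.1 y.1 + g.form x.2 y.2 := rfl

/-- The form `ψ₂` on `R²` with Gram matrix `!![0, 1; -1, 0]`. -/
def psi2 (R : Type u) [CommRing R] : AltIso R (R × R) where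
  form := LinearMap.mk₂ R (fun x y => x.1 * y.2 - x.2 * y.1)
    (by intros; simp; ring) (by intros; simp; ring) (by intros; simp; ring) (by intros; simp; ring)
  alt p := by simp [mul_comm]
  bij := by
    constructor
    · intro x y hxy
      apply Prod.ext
      · simpa using LinearMap.congr_fun hxy (0, 1)
      · simpa using LinearMap.congr_fun hxy (1, 0)
    · intro l
      refine ⟨(l (0, 1), - l (1, 0)), ?_⟩
      ext <;> simp

@[simp]
lemma psi2_apply (x y : R × R) : (psi2 R).form x y = x.1 * y.2 - x.2 * y.1 := rfl

end AltIso

/-! ### Alternating matrices: `ψ₂ₙ` and the Pfaffian -/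

/-- The matrix `ψ₂ₙ = ψ₂ ⊥ … ⊥ ψ₂` (`n` blocks). -/
def psiMatrix (R : Type u) [CommRing R] (n : ℕ) : Matrix (Fin (2 * n)) (Fin (2 * n)) R :=
  Matrix.of fun i j =>
    if (i : ℕ) + 1 = j ∧ Even (i : ℕ) then 1
    else if (j : ℕ) + 1 = i ∧ Even (j : ℕ) then -1 else 0

/-- The Pfaffian of an alternating `2n × 2n` matrix, by expansion along the first row. -/
def pfaffian {R : Type u} [CommRing R] : (n : ℕ) → Matrix (Fin (2 * n)) (Fin (2 * n)) R → R
  | 0, _ => 1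
  | n + 1, A => ∑ j : Fin (2 * n + 1), (-1) ^ (j : ℕ) * A (0 : Fin (2 * n + 2)) j.succ *
      pfaffian n (A.submatrix (fun i => ((j.succAbove i).succ : Fin (2 * n + 2)))
        (fun i => ((j.succAbove i).succ : Fin (2 * n + 2))))

/-- The index paired with `i` in `ψ₂ₙ`. -/
def partner (n : ℕ) (i : Fin (2 * n)) : Fin (2 * n) :=
  ⟨if Even (i : ℕ) then i + 1 else i - 1, by
    have := i.2
    split_ifs with h
    · obtain ⟨k, hk⟩ := h; omega
    · omega⟩

lemma psiMatrix_apply (R : Type u) [CommRing R] (n : ℕ) (i j : Fin (2 * n)) :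
    psiMatrix R n i j = if j = partner n i then (if Even (i : ℕ) then 1 else -1) else 0 := by
  have e : j = partner n i ↔ (j : ℕ) = if Even (i : ℕ) then (i : ℕ) + 1 else i - 1 := by
    simp [Fin.ext_iff, partner]
  simp only [psiMatrix, Matrix.of_apply, e]
  rcases Nat.even_or_odd (i : ℕ) with hi | hi
  · have h2 : ¬ ((j : ℕ) + 1 = i ∧ Even (j : ℕ)) := by
      rintro ⟨h, hj⟩
      rw [← h] at hi
      exact (Nat.not_even_iff_odd.2 hj.add_one) hi
    simp only [hi, and_true, h2, if_true, if_false]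
    by_cases h3 : (i : ℕ) + 1 = j
    · simp [h3]
    · simp [h3, Ne.symm h3]
  · have h1 : ¬ Even (i : ℕ) := Nat.not_even_iff_odd.2 hi
    have h2 : ((j : ℕ) + 1 = i ∧ Even (j : ℕ)) ↔ (j : ℕ) = i - 1 := by
      obtain ⟨k, hk⟩ := hi
      constructor
      · omega
      · intro h
        exact ⟨by omega, k, by omega⟩
    simp only [h1, and_false, if_false, h2]

lemma partner_partner (n : ℕ) (i : Fin (2 * n)) : partner n (partner n i) = i := by
  apply Fin.ext
  simp only [partner]
  rcases Nat.even_or_odd (i : ℕ) with hi | hi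
  · have : ¬ Even ((i : ℕ) + 1) := Nat.not_even_iff_odd.2 hi.add_one
    simp [hi, this]
  · have h1 : ¬ Even (i : ℕ) := Nat.not_even_iff_odd.2 hi
    have h2 : Even ((i : ℕ) - 1) := by obtain ⟨k, hk⟩ := hi; exact ⟨k, by omega⟩
    simp only [h1, h2, if_true, if_false]
    obtain ⟨k, hk⟩ := hi
    omega

lemma even_partner (n : ℕ) (i : Fin (2 * n)) :
    Even ((partner n i : Fin (2 * n)) : ℕ) ↔ ¬ Even (i : ℕ) := by
  simp only [partner]
  rcases Nat.even_or_odd (i : ℕ) with hi | hi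
  · simp [hi, Nat.not_even_iff_odd.2 hi.add_one]
  · have h1 : ¬ Even (i : ℕ) := Nat.not_even_iff_odd.2 hi
    have h2 : Even ((i : ℕ) - 1) := by obtain ⟨k, hk⟩ := hi; exact ⟨k, by omega⟩
    simp [h1, h2]

/-- The sign of the `i`-th row of `ψ₂ₙ`. -/
def psiSign (R : Type u) [CommRing R] (n : ℕ) (i : Fin (2 * n)) : R :=
  if Even (i : ℕ) then 1 else -1

lemma psiSign_partner (R : Type u) [CommRing R] (n : ℕ) (i : Fin (2 * n)) :
    psiSign R n (partner n i) = - psiSign R n i := by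
  by_cases h : Even (i : ℕ)
  · rw [psiSign, psiSign, if_neg ((even_partner n i).not.2 (not_not.2 h)), if_pos h]
  · rw [psiSign, psiSign, if_pos ((even_partner n i).2 h), if_neg h, neg_neg]

lemma psiSign_mul_self (R : Type u) [CommRing R] (n : ℕ) (i : Fin (2 * n)) :
    psiSign R n i * psiSign R n i = 1 := by
  by_cases h : Even (i : ℕ) <;> simp [psiSign, h]

/-- The bilinear form on `R²ⁿ` with Gram matrix `ψ₂ₙ`. -/
def psiForm (R : Type u) [CommRing R] (n : ℕ) :
    (Fin (2 * n) → R) →ₗ[R] (Fin (2 * n) → R) →ₗ[R] R :=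
  Matrix.toLinearMap₂' R (psiMatrix R n)

lemma psiForm_apply (R : Type u) [CommRing R] (n : ℕ) (x y : Fin (2 * n) → R) :
    psiForm R n x y = ∑ i, psiSign R n i * x i * y (partner n i) := by
  rw [psiForm, Matrix.toLinearMap₂'_apply]
  refine Finset.sum_congr rfl fun i _ => ?_
  rw [Finset.sum_eq_single (partner n i)]
  · rw [psiMatrix_apply, if_pos rfl]
    simp only [smul_eq_mul, psiSign]
    ring
  · intro j _ hj
    rw [psiMatrix_apply, if_neg hj]
    simp
  · simp

lemma psiForm_single (R : Type u) [CommRing R] (n : ℕ) (x : Fin (2 * n) → R) (i : Fin (2 * n)) :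
    psiForm R n x (Pi.single (partner n i) 1) = psiSign R n i * x i := by
  rw [psiForm_apply, Finset.sum_eq_single i]
  · simp
  · intro j _ hj
    have : partner n j ≠ partner n i := fun h => hj (by
      rw [← partner_partner n j, h, partner_partner])
    simp [this]
  · simp

/-- The form on `R²ⁿ` with Gram matrix `ψ₂ₙ`, as an alternating isomorphism. -/
def AltIso.psi (R : Type u) [CommRing R] (n : ℕ) : AltIso R (Fin (2 * n) → R) where
  form := psiForm R n
  alt p := by
    rw [psiForm_apply]
    refine Finset.sum_involution (fun i _ => partner n i) ?_ ?_ (by simp) ?_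
    · intro i _
      rw [partner_partner, psiSign_partner]
      ring
    · intro i _ _ h
      have := even_partner n i
      rw [h] at this
      tauto
    · intro i _
      exact partner_partner n i
  bij := by
    constructor
    · intro x y hxy
      funext i
      have := LinearMap.congr_fun hxy (Pi.single (partner n i) 1)
      rw [psiForm_single, psiForm_single] at this
      have h := congrArg (psiSign R n i * ·) this
      simpa only [← mul_assoc, psiSign_mul_self, one_mul] using h
    · intro l
      refine ⟨fun i => psiSign R n i * l (Pi.single (partner n i) 1), ?_⟩
      apply LinearMap.pi_ext'
      intro j
      ext
      simp only [LinearMap.comp_apply, LinearMap.coe_single]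
      rw [← partner_partner n j, psiForm_single, ← mul_assoc, psiSign_mul_self, one_mul]

/-- The Gram matrix of a form on `Rᵐ`. -/
def AltIso.gram {R : Type u} [CommRing R] {m : ℕ} (f : AltIso R (Fin m → R)) :
    Matrix (Fin m) (Fin m) R :=
  Matrix.of fun i j => f.form (Pi.single i 1) (Pi.single j 1)

/-! ### `Um(P)`, `SL(P)`, `E(P ⊕ Q)` and orbits -/

/-- `Um(P)`: the epimorphisms `P → R`. -/
def Um (R : Type u) [CommRing R] (P : Type v) [AddCommGroup P] [Module R P] : Type (max u v) :=
  {a : P →ₗ[R] R // Function.Surjective a}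

/-- The right action of `Aut(P)` on `Um(P)` by precomposition. -/
def Um.comp {R : Type u} [CommRing R] {P : Type v} [AddCommGroup P] [Module R P]
    (a : Um R P) (φ : P ≃ₗ[R] P) : Um R P :=
  ⟨a.1 ∘ₗ φ.toLinearMap, a.2.comp φ.surjective⟩

/-- `SL(P)` for a finitely generated projective module `P`: the automorphisms of determinant `1`.
The determinant of an automorphism of `P` is the element of `R` whose image in each local ring
`R_𝔭` is the determinant of the induced automorphism of the finite free `R_𝔭`-module `P_𝔭`; hence
it is `1` if and only if all these local determinants are `1`. -/
def SL (R : Type u) [CommRing R] (P : Type v) [AddCommGroup P] [Module R P] :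
    Subgroup (P ≃ₗ[R] P) where
  carrier := {φ | ∀ p : PrimeSpectrum R,
    LinearMap.det (φ.toLinearMap.baseChange (Localization.AtPrime p.asIdeal)) = 1}
  one_mem' p := by
    have : ((1 : P ≃ₗ[R] P) : P →ₗ[R] P) = LinearMap.id := rfl
    rw [this, LinearMap.baseChange_id, LinearMap.det_id]
  mul_mem' {φ χ} hφ hχ p := by
    have : ((φ * χ : P ≃ₗ[R] P) : P →ₗ[R] P) = φ.toLinearMap ∘ₗ χ.toLinearMap := rfl
    rw [this, LinearMap.baseChange_comp, LinearMap.det_comp, hφ p, hχ p, mul_one]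
  inv_mem' {φ} hφ p := by
    have h : φ.toLinearMap ∘ₗ ((φ⁻¹ : P ≃ₗ[R] P) : P →ₗ[R] P) = LinearMap.id := by
      ext x
      exact φ.apply_symm_apply x
    have h2 := congrArg (fun f => LinearMap.det
      (f.baseChange (Localization.AtPrime p.asIdeal))) h
    simp only [LinearMap.baseChange_comp, LinearMap.det_comp, LinearMap.baseChange_id,
      LinearMap.det_id] at h2
    rwa [hφ p, one_mul] at h2

lemma transvection_mem_SL {R : Type u} [CommRing R] {P : Type v} [AddCommGroup P] [Module R P]
    {f : Module.Dual R P} {x : P} (h : f x = 0) : LinearEquiv.transvection h ∈ SL R P := by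
  intro p
  by_cases hfree : Module.Free (Localization.AtPrime p.asIdeal)
      (Localization.AtPrime p.asIdeal ⊗[R] P)
  · by_cases hfin : Module.Finite (Localization.AtPrime p.asIdeal)
        (Localization.AtPrime p.asIdeal ⊗[R] P)
    · have e : (LinearEquiv.transvection h).toLinearMap = LinearMap.transvection f x := rfl
      rw [e, LinearMap.transvection.baseChange, LinearMap.transvection.det]
      simp [h]
    · by_contra hne
      exact hfin (LinearMap.finite_of_det_ne_one hne)
  · by_contra hne
    exact hfree (LinearMap.free_of_det_ne_one hne)

/-- `φ` is an elementary automorphism of `P ⊕ Q`, i.e. `id + s` with `s : P → Q` or `s : Q → P`. -/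
def IsElementary {R : Type u} [CommRing R] {P : Type v} [AddCommGroup P] [Module R P]
    {Q : Type w} [AddCommGroup Q] [Module R Q] (φ : (P × Q) ≃ₗ[R] (P × Q)) : Prop :=
  (∃ s : P →ₗ[R] Q, ∀ x, φ x = (x.1, x.2 + s x.1)) ∨
    (∃ s : Q →ₗ[R] P, ∀ x, φ x = (x.1 + s x.2, x.2))

/-- `E(P ⊕ Q)`: the subgroup of `Aut(P ⊕ Q)` generated by the elementary automorphisms. -/
def E (R : Type u) [CommRing R] (P : Type v) [AddCommGroup P] [Module R P]
    (Q : Type w) [AddCommGroup Q] [Module R Q] : Subgroup ((P × Q) ≃ₗ[R] (P × Q)) :=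
  Subgroup.closure {φ | IsElementary φ}

/-- Two elements of `Um(P)` are related if they lie in the same orbit of `G ≤ Aut(P)`. -/
def orbitRel {R : Type u} [CommRing R] {P : Type v} [AddCommGroup P] [Module R P]
    (G : Subgroup (P ≃ₗ[R] P)) : Setoid (Um R P) where
  r a b := ∃ φ ∈ G, b = a.comp φ
  iseqv :=
    { refl := fun a => ⟨1, G.one_mem, Subtype.ext (by ext; rfl)⟩
      symm := by
        rintro a b ⟨φ, hφ, rfl⟩
        refine ⟨φ⁻¹, G.inv_mem hφ, Subtype.ext ?_⟩
        ext x
        exact congrArg a.1 (φ.apply_symm_apply x).symm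
      trans := by
        rintro a b c ⟨φ, hφ, rfl⟩ ⟨χ, hχ, rfl⟩
        exact ⟨φ * χ, G.mul_mem hφ hχ, rfl⟩ }

/-- The orbit space `Um(P)/G`. -/
def UmOrbits {R : Type u} [CommRing R] {P : Type v} [AddCommGroup P] [Module R P]
    (G : Subgroup (P ≃ₗ[R] P)) : Type (max u v) :=
  Quotient (orbitRel G)

/-- `G ≤ Aut(P)` acts transitively on `Um(P)`. -/
def ActsTransitivelyOnUm {R : Type u} [CommRing R] {P : Type v} [AddCommGroup P] [Module R P]
    (G : Subgroup (P ≃ₗ[R] P)) : Prop :=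
  ∀ a b : Um R P, ∃ φ ∈ G, b = a.comp φ

/-! ### The group `V_SL(R)` and its subgroup `Ṽ_SL(R)` -/

/-- A triple `(P, g, f)`: a finitely generated projective module with two alternating
isomorphisms. -/
structure Triple (R : Type u) [CommRing R] : Type (u + 1) where
  P : Type u
  [addCommGroup : AddCommGroup P]
  [module : Module R P]
  [finite : Module.Finite R P]
  [projective : Module.Projective R P]
  g : AltIso R P
  f : AltIso R P

attribute [instance] Triple.addCommGroup Triple.module Triple.finite Triple.projective

/-- Isometry of triples. -/
def isometry (R : Type u) [CommRing R] : Setoid (Triple R) where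
  r T T' := ∃ h : T.P ≃ₗ[R] T'.P, T.g = T'.g.pullback h ∧ T.f = T'.f.pullback h
  iseqv :=
    { refl := fun T => ⟨LinearEquiv.refl R T.P, rfl, rfl⟩
      symm := by
        rintro T T' ⟨h, hg, hf⟩
        refine ⟨h.symm, ?_, ?_⟩
        · rw [hg]; ext; simp
        · rw [hf]; ext; simp
      trans := by
        rintro T T' T'' ⟨h, hg, hf⟩ ⟨k, kg, kf⟩
        refine ⟨h.trans k, ?_, ?_⟩
        · rw [hg, kg]; rfl
        · rw [hf, kf]; rfl }

/-- The free abelian group on isometry classes of triples. -/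
abbrev FreeTriples (R : Type u) [CommRing R] : Type (u + 1) :=
  FreeAbelianGroup (Quotient (isometry R))

section

variable {R : Type u} [CommRing R]
  (P : Type u) [AddCommGroup P] [Module R P] [Module.Finite R P] [Module.Projective R P]

/-- The generator of the free abelian group given by the isometry class of `(P, g, f)`. -/
def gen (g f : AltIso R P) : FreeTriples R :=
  FreeAbelianGroup.of (Quotient.mk (isometry R) ⟨P, g, f⟩)

end

/-- The relations defining `V_SL(R)`. -/
inductive Relation (R : Type u) [CommRing R] : FreeTriples R → Prop
  | sum (P P' : Type u) [AddCommGroup P] [Module R P] [Module.Finite R P] [Module.Projective R P]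
      [AddCommGroup P'] [Module R P'] [Module.Finite R P'] [Module.Projective R P']
      (g f : AltIso R P) (g' f' : AltIso R P') :
      Relation R (gen (P × P') (g.perp g') (f.perp f') - (gen P g f + gen P' g' f'))
  | trans (P : Type u) [AddCommGroup P] [Module R P] [Module.Finite R P] [Module.Projective R P]
      (f₀ f₁ f₂ : AltIso R P) :
      Relation R (gen P f₀ f₁ + gen P f₁ f₂ - gen P f₀ f₂)
  | sl (P : Type u) [AddCommGroup P] [Module R P] [Module.Finite R P] [Module.Projective R P]
      (g f : AltIso R P) (φ : P ≃ₗ[R] P) (hφ : φ ∈ SL R P) :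
      Relation R (gen P g f - gen P g (f.pullback φ))

/-- The group `V_SL(R)`. -/
abbrev VSL (R : Type u) [CommRing R] : Type (u + 1) :=
  FreeTriples R ⧸ AddSubgroup.closure {x : FreeTriples R | Relation R x}

/-- The class `[P, g, f]` in `V_SL(R)`. -/
def VSL.mk {R : Type u} [CommRing R] (P : Type u) [AddCommGroup P] [Module R P]
    [Module.Finite R P] [Module.Projective R P] (g f : AltIso R P) : VSL R :=
  QuotientAddGroup.mk (gen P g f)

lemma VSL.mk_pullback {R : Type u} [CommRing R] (P : Type u) [AddCommGroup P] [Module R P]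
    [Module.Finite R P] [Module.Projective R P] (g f : AltIso R P) (φ : P ≃ₗ[R] P)
    (hφ : φ ∈ SL R P) : VSL.mk P g (f.pullback φ) = VSL.mk P g f := by
  apply Eq.symm
  rw [VSL.mk, VSL.mk, ← sub_eq_zero, ← QuotientAddGroup.mk_sub, QuotientAddGroup.eq_zero_iff]
  exact AddSubgroup.subset_closure (Relation.sl P g f φ hφ)

/-- (The underlying set of) the subgroup `Ṽ_SL(R)` of `V_SL(R)`: the image of `W_SL(R)`, the group
of classes of alternating invertible matrices `M` of even size with Pfaffian `1`, under the
isomorphism `W'_SL(R) ≅ V_SL(R)` that sends the class of a `2n × 2n` matrix `M` to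
`[R²ⁿ, ψ₂ₙ, M]`. An alternating invertible matrix is given here through the alternating
isomorphism on `R²ⁿ` of which it is the Gram matrix. -/
def tildeVSL (R : Type u) [CommRing R] : Set (VSL R) :=
  {x | ∃ (n : ℕ) (M : AltIso R (Fin (2 * n) → R)),
    pfaffian n M.gram = 1 ∧ x = VSL.mk (Fin (2 * n) → R) (AltIso.psi R n) M}

/-! ### The generalized Vaserstein symbol -/

section Rank2

variable {R : Type u} [CommRing R] {P : Type v} [AddCommGroup P] [Module R P]

lemma alt_swap {B : P →ₗ[R] P →ₗ[R] R} (hB : ∀ p, B p p = 0) (p q : P) : B q p = - B p q := by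
  have := hB (p + q)
  simp only [map_add, LinearMap.add_apply, hB, zero_add, add_zero] at this
  exact eq_neg_of_add_eq_zero_left this

lemma localGenerators [Module.Finite R P] [Module.Projective R P]
    (hr : Module.rankAtStalk (R := R) P = 2) (m : PrimeSpectrum R) :
    ∃ e₀ e₁ : P, ∀ p : P, ∃ t ∉ m.asIdeal, ∃ a b : R, t • p = a • e₀ + b • e₁ := by
  have hf : Module.finrank (Localization.AtPrime m.asIdeal)
      (LocalizedModule m.asIdeal.primeCompl P) = 2 := congrFun hr m
  have : Module.Free (Localization.AtPrime m.asIdeal)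
      (LocalizedModule m.asIdeal.primeCompl P) := Module.free_of_flat_of_isLocalRing
  let b := Module.finBasisOfFinrankEq _ _ hf
  obtain ⟨⟨e₀, s₀⟩, h₀⟩ := Quotient.exists_rep (b 0)
  obtain ⟨⟨e₁, s₁⟩, h₁⟩ := Quotient.exists_rep (b 1)
  replace h₀ : LocalizedModule.mk e₀ s₀ = b 0 := h₀
  replace h₁ : LocalizedModule.mk e₁ s₁ = b 1 := h₁
  refine ⟨e₀, e₁, fun p => ?_⟩
  have hp := b.sum_repr (LocalizedModule.mk p 1)
  rw [Fin.sum_univ_two, ← h₀, ← h₁] at hp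
  generalize b.repr (LocalizedModule.mk p 1) 0 = c₀ at hp
  generalize b.repr (LocalizedModule.mk p 1) 1 = c₁ at hp
  induction c₀ using Localization.induction_on with | _ c₀ =>
  induction c₁ using Localization.induction_on with | _ c₁ =>
  rw [LocalizedModule.mk_smul_mk, LocalizedModule.mk_smul_mk, LocalizedModule.mk_add_mk,
    LocalizedModule.mk_eq] at hp
  obtain ⟨t, ht⟩ := hp
  simp only [Submonoid.smul_def, smul_add, smul_smul, one_smul] at ht
  refine ⟨_, ?_, _, _, ht.symm⟩
  exact (t * (c₀.2 * s₀ * (c₁.2 * s₁))).2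

/-- An alternating expression in three vectors of a rank two projective module vanishes. -/
lemma threeTerm [Module.Finite R P] [Module.Projective R P]
    (hr : Module.rankAtStalk (R := R) P = 2) {B : P →ₗ[R] P →ₗ[R] R} (hB : ∀ p, B p p = 0)
    (p q r : P) : B p q • r - B p r • q + B q r • p = 0 := by
  by_contra hne
  set x := B p q • r - B p r • q + B q r • p with hx
  obtain ⟨m, hm, hle⟩ := Ideal.exists_le_maximal (LinearMap.ker (LinearMap.toSpanSingleton R P x))
    (by
      intro h
      apply hne
      have : (1 : R) ∈ LinearMap.ker (LinearMap.toSpanSingleton R P x) := by rw [h]; trivial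
      simpa using this)
  obtain ⟨e₀, e₁, he⟩ := localGenerators hr ⟨m, hm.isPrime⟩
  obtain ⟨t, ht, a, b, hp⟩ := he p
  obtain ⟨t', ht', a', b', hq⟩ := he q
  obtain ⟨t'', ht'', a'', b'', hr⟩ := he r
  have h0 : (t * t' * t'') • x
      = B (t • p) (t' • q) • (t'' • r) - B (t • p) (t'' • r) • (t' • q)
        + B (t' • q) (t'' • r) • (t • p) := by
    rw [hx]
    simp only [map_smul, LinearMap.smul_apply, smul_eq_mul]
    module
  have h1 : (t * t' * t'') • x = 0 := by
    rw [h0, hp, hq, hr]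
    simp only [map_add, map_smul, LinearMap.add_apply, LinearMap.smul_apply, smul_eq_mul, hB,
      alt_swap hB e₀ e₁]
    module
  have h2 : t * t' * t'' ∈ m := hle (by simpa using h1)
  rcases hm.isPrime.mem_or_mem h2 with h | h
  · rcases hm.isPrime.mem_or_mem h with h | h
    · exact ht h
    · exact ht' h
  · exact ht'' h

lemma bijective_of_rank_two [Module.Finite R P] [Module.Projective R P]
    (hr : Module.rankAtStalk (R := R) P = 2) {B : P →ₗ[R] P →ₗ[R] R} (hB : ∀ p, B p p = 0)
    (hu : ∀ J : Ideal R, (∀ p q, B p q ∈ J) → (1 : R) ∈ J) : Function.Bijective B := by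
  constructor
  · rw [← LinearMap.ker_eq_bot, LinearMap.ker_eq_bot']
    intro p hp
    have := hu (LinearMap.ker (LinearMap.toSpanSingleton R P p)) (fun a b => by
      have h := threeTerm hr hB a b p
      rw [alt_swap hB p a, alt_swap hB p b, hp] at h
      simpa using h)
    simpa using this
  · intro l
    have := hu (Submodule.comap (LinearMap.toSpanSingleton R (P →ₗ[R] R) l) (LinearMap.range B))
      (fun a b => by
        refine ⟨l b • a - l a • b, ?_⟩
        ext r
        have h := congrArg l (threeTerm hr hB a b r)
        simp only [map_add, map_sub, map_smul, smul_eq_mul, map_zero] at h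
        simp only [map_sub, map_smul, LinearMap.sub_apply, LinearMap.smul_apply, smul_eq_mul,
          LinearMap.toSpanSingleton_apply]
        linear_combination -h)
    obtain ⟨p, hp⟩ := this
    exact ⟨p, by simpa using hp⟩

end Rank2

section Symbol

variable {R : Type u} [CommRing R] {P₀ : Type u} [AddCommGroup P₀] [Module R P₀]

/-- The bilinear form `(p, q) ↦ θ₀⁻¹ (p ∧ q)`. -/
def chiForm (θ₀ : R ≃ₗ[R] ⋀[R]^2 P₀) : P₀ →ₗ[R] P₀ →ₗ[R] R :=
  LinearMap.mk₂ R (fun p q => θ₀.symm (exteriorPower.ιMulti R 2 ![p, q]))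
    (fun p p' q => by
      have h := (exteriorPower.ιMulti R 2 (M := P₀)).map_vecCons_add ![q] p p'
      rw [h, map_add])
    (fun c p q => by
      have h := (exteriorPower.ιMulti R 2 (M := P₀)).map_vecCons_smul ![q] c p
      rw [h, map_smul])
    (fun p q q' => by
      have h := (exteriorPower.ιMulti R 2 (M := P₀)).map_update_add ![p, q] 1 q q'
      have e : ∀ z, Function.update ![p, q] 1 z = ![p, z] := fun z => by
        ext i; fin_cases i <;> rfl
      rw [e, e, e] at h
      rw [h, map_add])
    (fun c p q => by
      have h := (exteriorPower.ιMulti R 2 (M := P₀)).map_update_smul ![p, q] 1 c q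
      have e : ∀ z, Function.update ![p, q] 1 z = ![p, z] := fun z => by
        ext i; fin_cases i <;> rfl
      rw [e, e] at h
      rw [h, map_smul])

@[simp]
lemma chiForm_apply (θ₀ : R ≃ₗ[R] ⋀[R]^2 P₀) (p q : P₀) :
    chiForm θ₀ p q = θ₀.symm (exteriorPower.ιMulti R 2 ![p, q]) := rfl

lemma chiForm_alt (θ₀ : R ≃ₗ[R] ⋀[R]^2 P₀) (p : P₀) : chiForm θ₀ p p = 0 := by
  rw [chiForm_apply, (exteriorPower.ιMulti R 2).map_eq_zero_of_eq ![p, p] (i := 0) (j := 1) rfl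
    (by decide), map_zero]

lemma chiForm_unimodular (θ₀ : R ≃ₗ[R] ⋀[R]^2 P₀) (J : Ideal R)
    (hJ : ∀ p q, chiForm θ₀ p q ∈ J) : (1 : R) ∈ J := by
  have h : (⊤ : Submodule R (⋀[R]^2 P₀)) ≤ Submodule.comap θ₀.symm.toLinearMap J := by
    rw [← exteriorPower.ιMulti_span, Submodule.span_le]
    rintro _ ⟨v, rfl⟩
    have : v = ![v 0, v 1] := by ext i; fin_cases i <;> rfl
    rw [this]
    exact hJ _ _
  have h1 := h (show θ₀ 1 ∈ ⊤ from trivial)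
  simpa using h1


/-- The canonical non-degenerate alternating form `χ₀` on `P₀`, `χ₀ (p, q) = θ₀⁻¹ (p ∧ q)`. -/
def chi0 [Module.Finite R P₀] [Module.Projective R P₀]
    (hr : Module.rankAtStalk (R := R) P₀ = 2) (θ₀ : R ≃ₗ[R] ⋀[R]^2 P₀) : AltIso R P₀ where
  form := chiForm θ₀
  alt := chiForm_alt θ₀
  bij := bijective_of_rank_two hr (chiForm_alt θ₀) (chiForm_unimodular θ₀)

/-- The volume form of `P₀ ⊕ R`: the image of `x ∧ y ∧ z` under
`det (P₀ ⊕ R) ≅ det P₀ ≅ R`, where the first isomorphism is inverse to `p ∧ q ↦ p ∧ q ∧ (0, 1)`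
and the second one is `θ₀⁻¹`. -/
def vol (θ₀ : R ≃ₗ[R] ⋀[R]^2 P₀) (x y z : P₀ × R) : R :=
  chiForm θ₀ x.1 y.1 * z.2 - chiForm θ₀ x.1 z.1 * y.2 + chiForm θ₀ y.1 z.1 * x.2

/-- The bilinear form `(p, q) ↦ θ⁻¹ (p ∧ q)` on `P(a) = ker a`. Here `θ : R ≅ det P(a)` is `θ₀`
followed by the isomorphism `det P₀ ≅ det P(a)` coming from the exact sequence
`0 → P(a) → P₀ ⊕ R → R → 0`; since `det P(a) ≅ det (P(a) ⊕ R) ≅ det (P₀ ⊕ R)` is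
`p ∧ q ↦ p ∧ q ∧ s` for a section `s` of `a` (identified with its value at `1`), `θ⁻¹ (p ∧ q)` is
the volume of `p ∧ q ∧ s`. -/
def chiKerForm (θ₀ : R ≃ₗ[R] ⋀[R]^2 P₀) (a : Um R (P₀ × R)) (s : P₀ × R) :
    LinearMap.ker a.1 →ₗ[R] LinearMap.ker a.1 →ₗ[R] R :=
  LinearMap.mk₂ R (fun p q => vol θ₀ p q s)
    (by
      intros
      simp only [vol, Submodule.coe_add, Prod.fst_add, Prod.snd_add, map_add, LinearMap.add_apply]
      ring)
    (by
      intros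
      simp only [vol, Submodule.coe_smul, Prod.smul_fst, Prod.smul_snd, map_smul,
        LinearMap.smul_apply, smul_eq_mul]
      ring)
    (by
      intros
      simp only [vol, Submodule.coe_add, Prod.fst_add, Prod.snd_add, map_add, LinearMap.add_apply]
      ring)
    (by
      intros
      simp only [vol, Submodule.coe_smul, Prod.smul_fst, Prod.smul_snd, map_smul,
        LinearMap.smul_apply, smul_eq_mul]
      ring)

/-- The isomorphism `i_s : P₀ ⊕ R → P(a) ⊕ R`, `x ↦ (x - s (a x), a x)`. -/
def iota (a : Um R (P₀ × R)) (s : P₀ × R) (hs : a.1 s = 1) :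
    (P₀ × R) ≃ₗ[R] LinearMap.ker a.1 × R where
  toFun x := (⟨x - a.1 x • s, by simp [hs]⟩, a.1 x)
  invFun y := (y.1 : P₀ × R) + y.2 • s
  map_add' x y := by
    ext1
    · apply Subtype.ext
      simp only [map_add, Prod.fst_add, Submodule.coe_add]
      module
    · simp
  map_smul' c x := by
    ext1
    · apply Subtype.ext
      simp only [map_smul, Prod.smul_fst, Submodule.coe_smul, RingHom.id_apply, smul_eq_mul]
      module
    · simp
  left_inv x := by simp
  right_inv y := by
    have h : a.1 (y.1 : P₀ × R) = 0 := y.1.2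
    ext1
    · apply Subtype.ext
      simp [hs, h]
    · simp [hs, h]

lemma vol_transvect (θ₀ : R ≃ₗ[R] ⋀[R]^2 P₀) (α β : R) (x y d s : P₀ × R) :
    vol θ₀ (x + α • d) (y + β • d) s
      = vol θ₀ x y s + β * vol θ₀ x d s - α * vol θ₀ y d s := by
  have h := alt_swap (chiForm_alt θ₀)
  simp only [vol, Prod.fst_add, Prod.snd_add, Prod.smul_fst, Prod.smul_snd, map_add, map_smul,
    LinearMap.add_apply, LinearMap.smul_apply, smul_eq_mul, chiForm_alt]
  rw [h y.1 d.1]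
  ring

lemma vol_self_right (θ₀ : R ≃ₗ[R] ⋀[R]^2 P₀) (x s : P₀ × R) : vol θ₀ x s s = 0 := by
  simp only [vol, chiForm_alt]
  ring

section Ker

variable [Module.Finite R P₀] [Module.Projective R P₀]

lemma ker_finite (a : Um R (P₀ × R)) (s : P₀ × R) (hs : a.1 s = 1) :
    Module.Finite R (LinearMap.ker a.1) :=
  Module.Finite.of_surjective
    (LinearMap.fst R (LinearMap.ker a.1) R ∘ₗ (iota a s hs).toLinearMap)
    (Prod.fst_surjective.comp (iota a s hs).surjective)

lemma ker_projective (a : Um R (P₀ × R)) (s : P₀ × R) (hs : a.1 s = 1) :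
    Module.Projective R (LinearMap.ker a.1) :=
  Module.Projective.of_split (LinearMap.ker a.1).subtype
    (LinearMap.fst R (LinearMap.ker a.1) R ∘ₗ (iota a s hs).toLinearMap) (by
      ext x : 1
      have h : a.1 (x : P₀ × R) = 0 := x.2
      apply Subtype.ext
      simp [iota, h])

lemma ker_rank (hr : Module.rankAtStalk (R := R) P₀ = 2)
    (a : Um R (P₀ × R)) (s : P₀ × R) (hs : a.1 s = 1) :
    Module.rankAtStalk (R := R) (LinearMap.ker a.1) = 2 := by
  have := ker_finite a s hs
  have := ker_projective a s hs
  have h := Module.rankAtStalk_eq_of_equiv (iota a s hs)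
  rw [Module.rankAtStalk_prod, Module.rankAtStalk_prod, hr] at h
  exact (add_right_cancel h).symm

lemma chiKer_alt (θ₀ : R ≃ₗ[R] ⋀[R]^2 P₀) (a : Um R (P₀ × R)) (s : P₀ × R)
    (p : LinearMap.ker a.1) : chiKerForm θ₀ a s p p = 0 := by
  change vol θ₀ p p s = 0
  rw [vol, chiForm_alt]
  ring

lemma vol_fourTerm (hr : Module.rankAtStalk (R := R) P₀ = 2) (θ₀ : R ≃ₗ[R] ⋀[R]^2 P₀)
    (x y z m : P₀ × R) :
    vol θ₀ x y z • m - vol θ₀ x y m • z + vol θ₀ x z m • y - vol θ₀ y z m • x = 0 := by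
  have t := threeTerm hr (chiForm_alt θ₀)
  ext1
  · have h : (vol θ₀ x y z • m - vol θ₀ x y m • z + vol θ₀ x z m • y - vol θ₀ y z m • x).1
        = z.2 • (chiForm θ₀ x.1 y.1 • m.1 - chiForm θ₀ x.1 m.1 • y.1 + chiForm θ₀ y.1 m.1 • x.1)
          - m.2 • (chiForm θ₀ x.1 y.1 • z.1 - chiForm θ₀ x.1 z.1 • y.1 + chiForm θ₀ y.1 z.1 • x.1)
          - y.2 • (chiForm θ₀ x.1 z.1 • m.1 - chiForm θ₀ x.1 m.1 • z.1 + chiForm θ₀ z.1 m.1 • x.1)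
          + x.2 • (chiForm θ₀ y.1 z.1 • m.1 - chiForm θ₀ y.1 m.1 • z.1
            + chiForm θ₀ z.1 m.1 • y.1) := by
      simp only [vol, Prod.fst_add, Prod.fst_sub, Prod.smul_fst]
      module
    rw [h, t, t, t, t]
    simp
  · simp only [vol, Prod.snd_add, Prod.snd_sub, Prod.smul_snd, Prod.snd_zero, smul_eq_mul]
    ring

/-- Expansion of the volume form along `a`. -/
lemma vol_expand (hr : Module.rankAtStalk (R := R) P₀ = 2) (θ₀ : R ≃ₗ[R] ⋀[R]^2 P₀)
    (a : Um R (P₀ × R)) (s : P₀ × R) (hs : a.1 s = 1) (x y z : P₀ × R) :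
    vol θ₀ x y z = vol θ₀ x y s * a.1 z - vol θ₀ x z s * a.1 y + vol θ₀ y z s * a.1 x := by
  have h := congrArg a.1 (vol_fourTerm hr θ₀ x y z s)
  simp only [map_add, map_sub, map_smul, smul_eq_mul, map_zero, hs] at h
  linear_combination h

lemma chiKer_unimodular (hr : Module.rankAtStalk (R := R) P₀ = 2) (θ₀ : R ≃ₗ[R] ⋀[R]^2 P₀)
    (a : Um R (P₀ × R)) (s : P₀ × R) (hs : a.1 s = 1) (J : Ideal R)
    (hJ : ∀ p q, chiKerForm θ₀ a s p q ∈ J) : (1 : R) ∈ J := by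
  have h1 : ∀ x y, vol θ₀ x y s ∈ J := by
    intro x y
    have h := hJ ⟨x + (- a.1 x) • s, by simp [hs]⟩ ⟨y + (- a.1 y) • s, by simp [hs]⟩
    change vol θ₀ (x + (- a.1 x) • s) (y + (- a.1 y) • s) s ∈ J at h
    rw [vol_transvect, vol_self_right, vol_self_right] at h
    simpa using h
  have h2 : ∀ x y z, vol θ₀ x y z ∈ J := by
    intro x y z
    rw [vol_expand hr θ₀ a s hs]
    exact J.add_mem (J.sub_mem (J.mul_mem_right _ (h1 _ _)) (J.mul_mem_right _ (h1 _ _)))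
      (J.mul_mem_right _ (h1 _ _))
  refine chiForm_unimodular θ₀ J fun p q => ?_
  have h := h2 (p, 0) (q, 0) (0, 1)
  simpa only [vol, mul_one, mul_zero, sub_zero, add_zero] using h

/-- The non-degenerate alternating form `χ_a` on `P(a)`. -/
def chiKer (hr : Module.rankAtStalk (R := R) P₀ = 2) (θ₀ : R ≃ₗ[R] ⋀[R]^2 P₀)
    (a : Um R (P₀ × R)) (s : P₀ × R) (hs : a.1 s = 1) : AltIso R (LinearMap.ker a.1) where
  form := chiKerForm θ₀ a s
  alt := chiKer_alt θ₀ a s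
  bij := by
    have := ker_finite a s hs
    have := ker_projective a s hs
    exact bijective_of_rank_two (ker_rank hr a s hs) (chiKer_alt θ₀ a s)
      (chiKer_unimodular hr θ₀ a s hs)

/-- `i_s ⊕ 1 : P₀ ⊕ R² → P(a) ⊕ R²`. -/
def iotaOne (a : Um R (P₀ × R)) (s : P₀ × R) (hs : a.1 s = 1) :
    (P₀ × (R × R)) ≃ₗ[R] LinearMap.ker a.1 × (R × R) :=
  (LinearEquiv.prodAssoc R P₀ R R).symm ≪≫ₗ
    ((iota a s hs).prodCongr (LinearEquiv.refl R R)) ≪≫ₗ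
      LinearEquiv.prodAssoc R (LinearMap.ker a.1) R R

/-- The form `V(a, s) = (i_s ⊕ 1)ᵗ (χ_a ⊥ ψ₂) (i_s ⊕ 1)` on `P₀ ⊕ R²`. -/
def symbolForm (hr : Module.rankAtStalk (R := R) P₀ = 2) (θ₀ : R ≃ₗ[R] ⋀[R]^2 P₀)
    (a : Um R (P₀ × R)) (s : P₀ × R) (hs : a.1 s = 1) : AltIso R (P₀ × (R × R)) :=
  ((chiKer hr θ₀ a s hs).perp (AltIso.psi2 R)).pullback (iotaOne a s hs)

/-- The class `[P₀ ⊕ R², χ₀ ⊥ ψ₂, V(a, s)]` in `V_SL(R)`. -/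
def symbolClass (hr : Module.rankAtStalk (R := R) P₀ = 2) (θ₀ : R ≃ₗ[R] ⋀[R]^2 P₀)
    (a : Um R (P₀ × R)) (s : P₀ × R) (hs : a.1 s = 1) : VSL R :=
  VSL.mk (P₀ × (R × R)) ((chi0 hr θ₀).perp (AltIso.psi2 R)) (symbolForm hr θ₀ a s hs)

lemma symbolForm_apply (hr : Module.rankAtStalk (R := R) P₀ = 2) (θ₀ : R ≃ₗ[R] ⋀[R]^2 P₀)
    (a : Um R (P₀ × R)) (s : P₀ × R) (hs : a.1 s = 1) (x y : P₀ × (R × R)) :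
    (symbolForm hr θ₀ a s hs).form x y
      = vol θ₀ (x.1, x.2.1) (y.1, y.2.1) s
        + (a.1 (x.1, x.2.1) * y.2.2 - x.2.2 * a.1 (y.1, y.2.1)) := by
  change vol θ₀ ((x.1, x.2.1) - a.1 (x.1, x.2.1) • s) ((y.1, y.2.1) - a.1 (y.1, y.2.1) • s) s
        + (a.1 (x.1, x.2.1) * y.2.2 - x.2.2 * a.1 (y.1, y.2.1)) = _
  rw [sub_eq_add_neg, sub_eq_add_neg, ← neg_smul, ← neg_smul, vol_transvect, vol_self_right,
    vol_self_right]
  simp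

/-- The class `[P₀ ⊕ R², χ₀ ⊥ ψ₂, V(a, s)]` does not depend on the section. -/
lemma symbolClass_section (hr : Module.rankAtStalk (R := R) P₀ = 2) (θ₀ : R ≃ₗ[R] ⋀[R]^2 P₀)
    (a : Um R (P₀ × R)) (s s' : P₀ × R) (hs : a.1 s = 1) (hs' : a.1 s' = 1) :
    symbolClass hr θ₀ a s' hs' = symbolClass hr θ₀ a s hs := by
  let f : Module.Dual R (P₀ × (R × R)) := - (a.1 ∘ₗ
    (LinearMap.fst R P₀ (R × R)).prod (LinearMap.fst R R R ∘ₗ LinearMap.snd R P₀ (R × R)))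
  have hf : ∀ x, f x = - a.1 (x.1, x.2.1) := fun x => rfl
  let w : P₀ × (R × R) := ((s' - s).1, ((s' - s).2, 0))
  have hfw : f w = 0 := by
    rw [hf]
    change - a.1 (s' - s) = 0
    simp [hs, hs']
  have e : symbolForm hr θ₀ a s' hs'
      = (symbolForm hr θ₀ a s hs).pullback (LinearEquiv.transvection hfw) := by
    ext1
    apply LinearMap.ext
    intro x
    apply LinearMap.ext
    intro y
    rw [AltIso.pullback_apply, symbolForm_apply, symbolForm_apply]
    have hx : ∀ x : P₀ × (R × R), LinearEquiv.transvection hfw x = x + f x • w := fun x => rfl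
    have h1 : ∀ x : P₀ × (R × R), ((LinearEquiv.transvection hfw x).1,
        (LinearEquiv.transvection hfw x).2.1)
          = ((x.1, x.2.1) : P₀ × R) + (- a.1 (x.1, x.2.1)) • (s' - s) := fun x => by
      rw [hx, hf]; rfl
    have h2 : ∀ x : P₀ × (R × R), (LinearEquiv.transvection hfw x).2.2 = x.2.2 := fun x => by
      rw [hx]
      simp [w]
    have h3 : a.1 (s' - s) = 0 := by simp [hs, hs']
    rw [h1, h1, h2, h2, vol_transvect, vol_expand hr θ₀ a s hs _ _ s']
    have h4 : ∀ x, vol θ₀ x (s' - s) s = vol θ₀ x s' s := fun x => by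
      have := vol_transvect θ₀ 0 (-1) x s' s s
      simp only [zero_smul, add_zero, neg_smul, one_smul, vol_self_right, ← sub_eq_add_neg] at this
      simpa using this
    rw [h4, h4, map_add, map_add, map_smul, map_smul, h3, hs']
    simp only [smul_zero, add_zero]
    ring
  rw [symbolClass, symbolClass, e]
  exact VSL.mk_pullback _ _ _ _ (transvection_mem_SL hfw)

/-- `φ ⊕ 1` on `P₀ ⊕ R²` for an automorphism `φ` of `P₀ ⊕ R`. -/
def addOne (φ : (P₀ × R) ≃ₗ[R] (P₀ × R)) : (P₀ × (R × R)) ≃ₗ[R] (P₀ × (R × R)) :=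
  (LinearEquiv.prodAssoc R P₀ R R).symm ≪≫ₗ (φ.prodCongr (LinearEquiv.refl R R)) ≪≫ₗ
    LinearEquiv.prodAssoc R P₀ R R

lemma addOne_mem_SL (φ : (P₀ × R) ≃ₗ[R] (P₀ × R)) (hφ : IsElementary φ) :
    addOne φ ∈ SL R (P₀ × (R × R)) := by
  obtain ⟨s, hs⟩ | ⟨s, hs⟩ := hφ
  · have hf : (s ∘ₗ LinearMap.fst R P₀ (R × R)) ((0, (1, 0)) : P₀ × (R × R)) = 0 := by simp
    have : addOne φ = LinearEquiv.transvection (f := s ∘ₗ LinearMap.fst R P₀ (R × R)) hf := by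
      ext1 x
      have h : LinearEquiv.transvection (f := s ∘ₗ LinearMap.fst R P₀ (R × R)) hf x
        = x + s x.1 • ((0, (1, 0)) : P₀ × (R × R)) := rfl
      have h' : addOne φ x
        = ((φ (x.1, x.2.1)).1, ((φ (x.1, x.2.1)).2, x.2.2)) := rfl
      rw [h, h', hs]
      ext <;> simp
    rw [this]
    exact transvection_mem_SL hf
  · have hf : (LinearMap.fst R R R ∘ₗ LinearMap.snd R P₀ (R × R))
        ((s 1, (0, 0)) : P₀ × (R × R)) = 0 := by simp
    have : addOne φ = LinearEquiv.transvection hf := by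
      ext1 x
      have h : LinearEquiv.transvection hf x
        = x + x.2.1 • ((s 1, (0, 0)) : P₀ × (R × R)) := rfl
      have h' : addOne φ x
        = ((φ (x.1, x.2.1)).1, ((φ (x.1, x.2.1)).2, x.2.2)) := rfl
      have h'' : s x.2.1 = x.2.1 • s 1 := by rw [← map_smul, smul_eq_mul, mul_one]
      rw [h, h', hs]
      ext <;> simp [h'']
    rw [this]
    exact transvection_mem_SL hf

lemma vol_elementary (hr : Module.rankAtStalk (R := R) P₀ = 2) (θ₀ : R ≃ₗ[R] ⋀[R]^2 P₀)
    (φ : (P₀ × R) ≃ₗ[R] (P₀ × R)) (hφ : IsElementary φ) (x y z : P₀ × R) :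
    vol θ₀ (φ x) (φ y) (φ z) = vol θ₀ x y z := by
  obtain ⟨s, hs⟩ | ⟨s, hs⟩ := hφ
  · have h := congrArg s (threeTerm hr (chiForm_alt θ₀) x.1 y.1 z.1)
    simp only [map_add, map_sub, map_smul, smul_eq_mul, map_zero] at h
    simp only [hs, vol]
    linear_combination h
  · have h : ∀ c : R, s c = c • s 1 := fun c => by rw [← map_smul, smul_eq_mul, mul_one]
    simp only [hs, vol, h x.2, h y.2, h z.2, map_add, map_smul, LinearMap.add_apply,
      LinearMap.smul_apply, smul_eq_mul, chiForm_alt, alt_swap (chiForm_alt θ₀) y.1 (s 1)]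
    ring

lemma symbolClass_elementary (hr : Module.rankAtStalk (R := R) P₀ = 2)
    (θ₀ : R ≃ₗ[R] ⋀[R]^2 P₀) (a : Um R (P₀ × R)) (φ : (P₀ × R) ≃ₗ[R] (P₀ × R))
    (hφ : IsElementary φ) (s s' : P₀ × R) (hs : a.1 s = 1) (hs' : (a.comp φ).1 s' = 1) :
    symbolClass hr θ₀ (a.comp φ) s' hs' = symbolClass hr θ₀ a s hs := by
  have hs'' : a.1 (φ s') = 1 := hs'
  rw [← symbolClass_section hr θ₀ a s (φ s') hs hs'']
  have e : symbolForm hr θ₀ (a.comp φ) s' hs'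
      = (symbolForm hr θ₀ a (φ s') hs'').pullback (addOne φ) := by
    ext1
    apply LinearMap.ext
    intro x
    apply LinearMap.ext
    intro y
    rw [AltIso.pullback_apply, symbolForm_apply, symbolForm_apply]
    exact congrArg₂ (· + ·) (vol_elementary hr θ₀ φ hφ _ _ _).symm rfl
  rw [symbolClass, symbolClass, e]
  exact VSL.mk_pullback _ _ _ _ (addOne_mem_SL φ hφ)

/-- The map `Um(P₀ ⊕ R) → V_SL(R)`, `a ↦ [P₀ ⊕ R², χ₀ ⊥ ψ₂, V(a, s)]`, for any section `s`. -/
def symbolUm (hr : Module.rankAtStalk (R := R) P₀ = 2) (θ₀ : R ≃ₗ[R] ⋀[R]^2 P₀)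
    (a : Um R (P₀ × R)) : VSL R :=
  symbolClass hr θ₀ a (a.2 1).choose (a.2 1).choose_spec

lemma symbolUm_eq (hr : Module.rankAtStalk (R := R) P₀ = 2) (θ₀ : R ≃ₗ[R] ⋀[R]^2 P₀)
    (a : Um R (P₀ × R)) (s : P₀ × R) (hs : a.1 s = 1) :
    symbolUm hr θ₀ a = symbolClass hr θ₀ a s hs :=
  symbolClass_section hr θ₀ a s _ hs _

lemma symbolUm_comp (hr : Module.rankAtStalk (R := R) P₀ = 2) (θ₀ : R ≃ₗ[R] ⋀[R]^2 P₀)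
    (φ : (P₀ × R) ≃ₗ[R] (P₀ × R)) (hφ : φ ∈ E R P₀ R) (a : Um R (P₀ × R)) :
    symbolUm hr θ₀ (a.comp φ) = symbolUm hr θ₀ a := by
  induction hφ using Subgroup.closure_induction generalizing a with
  | mem φ hφ => exact symbolClass_elementary hr θ₀ a φ hφ _ _ _ _
  | one => rfl
  | mul φ χ _ _ h1 h2 =>
    have : a.comp (φ * χ) = (a.comp φ).comp χ := rfl
    rw [this, h2, h1]
  | inv φ _ h =>
    rw [← h]
    congr 1
    exact Subtype.ext (LinearMap.ext fun x => congrArg a.1 (φ.symm_apply_apply x))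

/-- The generalized Vaserstein symbol associated to `θ₀`, as a map
`Um(P₀ ⊕ R)/E(P₀ ⊕ R) → V_SL(R)`. -/
def vasersteinSymbol (hr : Module.rankAtStalk (R := R) P₀ = 2) (θ₀ : R ≃ₗ[R] ⋀[R]^2 P₀) :
    UmOrbits (E R P₀ R) → VSL R :=
  Quotient.lift (symbolUm hr θ₀) (by
    rintro a b ⟨φ, hφ, rfl⟩
    exact (symbolUm_comp hr θ₀ φ hφ a).symm)

end Ker

end Symbol

end GenVaserstein

end

/-! Everything rests on a coordinate-free Pfaffian. For an alternating form `f` on `P`, the Pfaffian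
of the Gram matrix of 2n vectors is an alternating map `f.pf n` on `P`. If `P` has constant rank 2n,
this map has top degree, so `SL(P)` fixes it (`alternating_comp_SL`). Thus "Pfaffian 1 relative to a
base form" makes sense on modules that are not free. Adding one common form to both entries of a
triple does not change its class (`VSL.mk_perp_self`).

Symbols lie in the subgroup. The Pfaffian of V(a, s) on (p, q, e₃, e₄), where e₃, e₄ is the standard
basis of the summand R², is χ₀(p, q)·a(s) = χ₀(p, q), as for χ₀ ⊥ ψ₂ (`pf_symbolForm`). The form χ₀
⊥ ψ₂ embeds isometrically in some ψ₂ₖ (`exists_isometric_map`); being non-degenerate, it has an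
orthogonal complement (N, h). Adding h to both entries turns the symbol into [R²ᵏ, ψ₂ₖ, M], and M
has the Pfaffian of ψ₂ₖ, which is 1.

Conversely, let M have size 2n and Pfaffian 1. Adding χ₀ gives [P₀ ⊕ R²ⁿ, χ₀ ⊥ ψ₂ₙ, χ₀ ⊥ M], whose
two forms have equal Pfaffians. Pairing with the last basis vector is a unimodular form on P₀ ⊕
R²ⁿ⁻¹. Once `SL` moves it to the last projection, one more transvection splits off a hyperbolic
plane, and Pfaffians stay equal (`exists_descend`). Transitivity is the hypothesis on P₅ for n = 2,
and follows from dimension at most 4 for n ≥ 3 (`transitive_of_dim_le_four`). What remains is a form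
on P₀ ⊕ R² with the Pfaffian of χ₀ ⊥ ψ₂. On P₀ ⊕ R it is the volume form contracted with a vector w;
its pairing with the last vector is a form a; equality of Pfaffians says a(w) = 1. So it is V(a, w)
(`exists_eq_symbolForm`). -/

noncomputable section

namespace GenVaserstein

/-! ### The Pfaffian as an alternating map -/

section Pfaffian

variable {R : Type*} [CommRing R] {M : Type*} [AddCommGroup M] [Module R M]

/-- Wedge product of the linear form `l` with the alternating map `F`. -/
def wedgeLeft {k : ℕ} (l : M →ₗ[R] R) (F : M [⋀^Fin k]→ₗ[R] R) : M [⋀^Fin (k + 1)]→ₗ[R] R :=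
  AlternatingMap.alternatizeUncurryFin (l.smulRight F)

lemma wedgeLeft_apply {k : ℕ} (l : M →ₗ[R] R) (F : M [⋀^Fin k]→ₗ[R] R) (v : Fin (k + 1) → M) :
    wedgeLeft l F v = ∑ i : Fin (k + 1), (-1) ^ (i : ℕ) * (l (v i) * F (i.removeNth v)) := by
  rw [wedgeLeft, AlternatingMap.alternatizeUncurryFin_apply]
  refine Finset.sum_congr rfl fun i _ => ?_
  rcases neg_one_pow_eq_or ℤ (i : ℕ) with h | h <;>
  rcases neg_one_pow_eq_or R (i : ℕ) with h' | h' <;>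
  simp [h']

/-- This is l ∧ l ∧ F = 0: the twice uncurried map is symmetric in its first two variables, and
alternatizing twice kills such maps. -/
lemma wedgeLeft_wedgeLeft {k : ℕ} (l : M →ₗ[R] R) (F : M [⋀^Fin k]→ₗ[R] R) :
    wedgeLeft l (wedgeLeft l F) = 0 := by
  have h := AlternatingMap.alternatizeUncurryFin_alternatizeUncurryFinLM_comp_of_symmetric
    (f := l.smulRight (l.smulRight F)) (fun x y => by
      simp only [LinearMap.smulRight_apply, LinearMap.smul_apply, smul_smul, mul_comm])
  rw [← h, wedgeLeft, wedgeLeft]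
  congr 1
  ext x v
  simp

/-- `wedgeLeft` as a linear map in the form, with values in multilinear maps. -/
def wedgeLeftLM {k : ℕ} (f : M →ₗ[R] M →ₗ[R] R) (F : M [⋀^Fin k]→ₗ[R] R) :
    M →ₗ[R] MultilinearMap R (fun _ : Fin (k + 1) => M) R where
  toFun x := (wedgeLeft (f x) F).toMultilinearMap
  map_add' x y := by
    ext v
    simp [wedgeLeft_apply, add_mul, mul_add, Finset.sum_add_distrib]
  map_smul' c x := by
    ext v
    simp only [map_smul, AlternatingMap.coe_multilinearMap, wedgeLeft_apply, LinearMap.smul_apply,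
      smul_eq_mul, RingHom.id_apply, smul_apply, Finset.mul_sum]
    exact Finset.sum_congr rfl fun i _ => by ring

/-- One step of the recursive construction of the Pfaffian: `F` raised by two degrees. -/
def pfStep {k : ℕ} (f : M →ₗ[R] M →ₗ[R] R) (F : M [⋀^Fin k]→ₗ[R] R)
    (h : ∀ x w, wedgeLeft (f x) F (Fin.cons x w : Fin (k + 1) → M) = 0) :
    M [⋀^Fin (k + 2)]→ₗ[R] R where
  toMultilinearMap := (wedgeLeftLM f F).uncurryLeft
  map_eq_zero_of_eq' v i j hv hij := by
    -- A repetition of `v 0` in the tail can be moved to the front of the tail at the cost of a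
    -- sign, where `h` applies. Repetitions inside the tail are covered by `wedgeLeft` being
    -- alternating.
    have key : ∀ j : Fin (k + 1), v 0 = v j.succ → wedgeLeft (f (v 0)) F (Fin.tail v) = 0 := by
      intro j hj
      have : Fin.tail v = j.insertNth (v 0) (j.removeNth (Fin.tail v)) := by
        rw [hj]
        exact (Fin.insertNth_self_removeNth j (Fin.tail v)).symm
      rw [this, AlternatingMap.map_insertNth]
      have h' := h (v 0) (j.removeNth (Fin.tail v))
      rw [Matrix.vecCons, h', smul_zero]
    change wedgeLeft (f (v 0)) F (Fin.tail v) = 0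
    induction i using Fin.cases with
    | zero =>
      induction j using Fin.cases with
      | zero => exact absurd rfl hij
      | succ j => exact key j hv
    | succ i =>
      induction j using Fin.cases with
      | zero => exact key i hv.symm
      | succ j =>
        exact AlternatingMap.map_eq_zero_of_eq _ _ hv fun h' => hij (by rw [h'])

lemma pfStep_apply {k : ℕ} (f : M →ₗ[R] M →ₗ[R] R) (F : M [⋀^Fin k]→ₗ[R] R)
    (h : ∀ x w, wedgeLeft (f x) F (Fin.cons x w : Fin (k + 1) → M) = 0) (v : Fin (k + 2) → M) :
    pfStep f F h v = wedgeLeft (f (v 0)) F (Fin.tail v) := rfl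

/-- The vanishing hypothesis of `pfStep` reproduces itself, so the recursion can continue. In the
expansion at (x, w) the first term contains f(x, x) = 0; in the others the deleted tuple still
starts with x, so together they form -(f(x) ∧ f(x) ∧ F)(w) = 0. -/
lemma wedgeLeft_pfStep {k : ℕ} {f : M →ₗ[R] M →ₗ[R] R} (hf : ∀ x, f x x = 0)
    (F : M [⋀^Fin k]→ₗ[R] R)
    (h : ∀ x w, wedgeLeft (f x) F (Fin.cons x w : Fin (k + 1) → M) = 0) (x : M)
    (w : Fin (k + 2) → M) :
    wedgeLeft (f x) (pfStep f F h) (Fin.cons x w : Fin (k + 3) → M) = 0 := by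
  have h2 := congrArg (fun G => G w) (wedgeLeft_wedgeLeft (f x) F)
  simp only [AlternatingMap.zero_apply] at h2
  rw [wedgeLeft_apply] at h2
  rw [wedgeLeft_apply, Fin.sum_univ_succ]
  simp only [Fin.cons_zero, hf, zero_mul, mul_zero, zero_add, Fin.cons_succ, pfStep_apply,
    Fin.val_succ, pow_succ]
  rw [← neg_eq_zero, ← Finset.sum_neg_distrib, ← h2]
  refine Finset.sum_congr rfl fun i _ => ?_
  have e : Fin.removeNth (α := fun _ => M) i.succ (Fin.cons x w)
      = Fin.cons x (i.removeNth w) := by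
    funext j
    induction j using Fin.cases <;> simp [Fin.removeNth]
  rw [e, Fin.cons_zero, Fin.tail_cons]
  ring

/-- The Pfaffian with its defining vanishing property. -/
def pfAux (f : M →ₗ[R] M →ₗ[R] R) (hf : ∀ x, f x x = 0) : (n : ℕ) →
    {F : M [⋀^Fin (2 * n)]→ₗ[R] R //
      ∀ x w, wedgeLeft (f x) F (Fin.cons x w : Fin (2 * n + 1) → M) = 0}
  | 0 => ⟨@AlternatingMap.constOfIsEmpty R _ M _ _ R _ _ (Fin 0) _ 1, fun x w => by
      rw [wedgeLeft_apply]
      simp [hf]⟩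
  | n + 1 => ⟨pfStep f (pfAux f hf n).1 (pfAux f hf n).2, wedgeLeft_pfStep hf _ _⟩

/-- The Pfaffian of the Gram matrix of `2n` vectors, as an alternating map. -/
def pfMap (f : M →ₗ[R] M →ₗ[R] R) (hf : ∀ x, f x x = 0) (n : ℕ) : M [⋀^Fin (2 * n)]→ₗ[R] R :=
  (pfAux f hf n).1

lemma pfMap_zero (f : M →ₗ[R] M →ₗ[R] R) (hf : ∀ x, f x x = 0) (v : Fin (2 * 0) → M) :
    pfMap f hf 0 v = 1 := rfl

lemma pfMap_succ (f : M →ₗ[R] M →ₗ[R] R) (hf : ∀ x, f x x = 0) (n : ℕ)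
    (v : Fin (2 * n + 2) → M) :
    pfMap f hf (n + 1) v = ∑ i : Fin (2 * n + 1), (-1) ^ (i : ℕ) *
      (f (v 0) (v i.succ) * pfMap f hf n (i.removeNth (Fin.tail v))) :=
  wedgeLeft_apply _ _ _

lemma pfMap_eq_pfaffian (f : M →ₗ[R] M →ₗ[R] R) (hf : ∀ x, f x x = 0) (n : ℕ)
    (v : Fin (2 * n) → M) :
    pfMap f hf n v = pfaffian n (Matrix.of fun i j => f (v i) (v j)) := by
  induction n with
  | zero => rfl
  | succ n ih =>
    rw [pfaffian]
    refine (pfMap_succ f hf n v).trans (Finset.sum_congr rfl fun i _ => ?_)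
    rw [ih, ← mul_assoc]
    rfl

/-- The Pfaffian depends only on the Gram matrix, so it may be computed after passing to a pullback
or to an orthogonal summand. -/
lemma pfMap_comp {M' : Type*} [AddCommGroup M'] [Module R M'] (f : M →ₗ[R] M →ₗ[R] R)
    (hf : ∀ x, f x x = 0) (f' : M' →ₗ[R] M' →ₗ[R] R) (hf' : ∀ x, f' x x = 0) {n : ℕ}
    (v : Fin (2 * n) → M) (v' : Fin (2 * n) → M')
    (h : ∀ i j, f (v i) (v j) = f' (v' i) (v' j)) : pfMap f hf n v = pfMap f' hf' n v' := by
  rw [pfMap_eq_pfaffian, pfMap_eq_pfaffian]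
  congr 1
  ext i j
  exact h i j

/-- Splitting off an orthogonal pair of vectors. -/
lemma pfMap_cons_cons (f : M →ₗ[R] M →ₗ[R] R) (hf : ∀ x, f x x = 0) {n : ℕ} (x y : M)
    (v : Fin (2 * n) → M) (hx : ∀ i, f x (v i) = 0) :
    pfMap f hf (n + 1) (Fin.cons x (Fin.cons y v : Fin (2 * n + 1) → M) : Fin (2 * n + 2) → M)
      = f x y * pfMap f hf n v := by
  rw [pfMap_succ, Finset.sum_eq_single 0]
  · simp
  · intro i _ hi
    obtain ⟨j, rfl⟩ := Fin.exists_succ_eq.2 hi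
    simp [hx]
  · simp

/-- Splitting off an orthogonal quadruple of vectors. -/
lemma pfMap_cons_four (f : M →ₗ[R] M →ₗ[R] R) (hf : ∀ x, f x x = 0) {n : ℕ} (x y z t : M)
    (v : Fin (2 * n) → M) (hx : ∀ i, f x (v i) = 0) (hy : ∀ i, f y (v i) = 0)
    (hz : ∀ i, f z (v i) = 0) :
    pfMap f hf (n + 2) (Fin.cons x (Fin.cons y (Fin.cons z (Fin.cons t v : Fin (2 * n + 1) → M)
        : Fin (2 * n + 2) → M) : Fin (2 * n + 3) → M) : Fin (2 * n + 4) → M)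
      = (f x y * f z t - f x z * f y t + f x t * f y z) * pfMap f hf n v := by
  refine (pfMap_succ f hf (n + 1) _).trans ?_
  have e0 : ∀ (k : ℕ) (x : M) (w : Fin k → M),
      Fin.removeNth (α := fun _ => M) 0 (Fin.cons x w : Fin (k + 1) → M) = w := fun k x w => by
    funext j; simp [Fin.removeNth]
  have e1 : ∀ (k : ℕ) (i : Fin (k + 1)) (x : M) (w : Fin (k + 1) → M),
      Fin.removeNth (α := fun _ => M) i.succ (Fin.cons x w : Fin (k + 2) → M)
        = Fin.cons x (i.removeNth w) := fun k i x w => by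
    funext j
    induction j using Fin.cases <;> simp [Fin.removeNth]
  let c (a b : M) : Fin (2 * n + 2) → M := Fin.cons a (Fin.cons b v : Fin (2 * n + 1) → M)
  change ∑ i : Fin (2 * n + 2 + 1), (-1) ^ (i : ℕ) *
      (f x ((Fin.cons y (c z t) : Fin (2 * n + 2 + 1) → M) i) * pfMap f hf (n + 1)
        (i.removeNth (Fin.cons y (c z t) : Fin (2 * n + 2 + 1) → M))) = _
  have a1 : (0 : Fin (2 * n + 2 + 1)).removeNth (α := fun _ => M) (Fin.cons y (c z t)) = c z t :=
    e0 _ _ _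
  have a2 : (Fin.succ 0 : Fin (2 * n + 2 + 1)).removeNth (α := fun _ => M) (Fin.cons y (c z t))
      = c y t := by
    rw [e1 (2 * n + 1) 0]
    exact congrArg _ (e0 _ _ _)
  have a3 : (Fin.succ (Fin.succ 0) : Fin (2 * n + 2 + 1)).removeNth (α := fun _ => M)
      (Fin.cons y (c z t)) = c y z := by
    rw [e1 (2 * n + 1) (Fin.succ 0)]
    exact congrArg _ ((e1 (2 * n) 0 z (Fin.cons t v)).trans (congrArg _ (e0 _ _ _)))
  have h1 : pfMap f hf (n + 1) (c z t) = _ := pfMap_cons_cons f hf z t v hz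
  have h2 : pfMap f hf (n + 1) (c y t) = _ := pfMap_cons_cons f hf y t v hy
  have h3 : pfMap f hf (n + 1) (c y z) = _ := pfMap_cons_cons f hf y z v hy
  rw [Fin.sum_univ_succ, Fin.sum_univ_succ, Fin.sum_univ_succ, Finset.sum_eq_zero, a1, a2, a3, h1,
    h2, h3]
  · simp only [c, Fin.cons_zero, Fin.cons_succ, Fin.val_zero, Fin.val_succ]
    ring
  · intro i _
    simp [hx, c]

lemma pfaffian_psiMatrix (R : Type*) [CommRing R] (n : ℕ) : pfaffian n (psiMatrix R n) = 1 := by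
  induction n with
  | zero => rfl
  | succ n ih =>
    rw [pfaffian, Finset.sum_eq_single 0]
    · rw [← ih]
      have e : (psiMatrix R (n + 1)).submatrix
          (fun i => (((0 : Fin (2 * n + 1)).succAbove i).succ : Fin (2 * n + 2)))
          (fun i => (((0 : Fin (2 * n + 1)).succAbove i).succ : Fin (2 * n + 2)))
          = psiMatrix R n := by
        ext i j
        simp only [psiMatrix, Matrix.submatrix_apply, Matrix.of_apply, Fin.zero_succAbove,
          Fin.val_succ]
        simp only [add_left_inj, Nat.even_add_one, not_not]
      rw [e, ih]
      simp [psiMatrix, Nat.mod_eq_of_lt (show 1 < 2 * (n + 1) by omega)]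
    · intro i _ hi
      obtain ⟨j, rfl⟩ := Fin.exists_succ_eq.2 hi
      simp [psiMatrix]
    · simp

end Pfaffian

/-! ### Alternating maps of top degree on projective modules -/

section TopDegree

variable {R : Type*} [CommRing R] {P : Type*} [AddCommGroup P] [Module R P]

/-- Pulled back to Rᵏ along the standard basis ↦ `v`, the map `G` is a multiple of the determinant.
-/
lemma alternating_linearCombination {k : ℕ} (G : P [⋀^Fin k]→ₗ[R] R) (v w : Fin k → P)
    (c : Matrix (Fin k) (Fin k) R) (h : ∀ i, w i = ∑ j, c i j • v j) : G w = c.det * G v := by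
  have h1 := DFunLike.congr_fun
    ((G.compLinearMap (Fintype.linearCombination R v)).eq_smul_basis_det (Pi.basisFun R (Fin k)))
    (fun i j => c i j)
  have e1 : (fun i => Fintype.linearCombination R v (fun j => c i j)) = w := by
    funext i
    rw [h, Fintype.linearCombination_apply]
  have e2 : (fun i => Fintype.linearCombination R v (Pi.basisFun R (Fin k) i)) = v := by
    funext i
    simp [Fintype.linearCombination_apply, Pi.single_apply, ite_smul]
  rw [AlternatingMap.smul_apply, Pi.basisFun_det_apply, AlternatingMap.compLinearMap_apply,
    AlternatingMap.compLinearMap_apply, e1, e2, smul_eq_mul, mul_comm] at h1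
  exact h1

/-- Clear the denominators of the coordinates of 1 ⊗ x; the resulting equality holds after
localization, hence in `P` after one more multiplication. -/
lemma exists_smul_eq_sum (m : PrimeSpectrum R) {k : ℕ} (v : Fin k → P)
    (b : Module.Basis (Fin k) (Localization.AtPrime m.asIdeal)
      (Localization.AtPrime m.asIdeal ⊗[R] P))
    (hb : ∀ i, b i = 1 ⊗ₜ v i) (x : P) :
    ∃ t ∉ m.asIdeal, ∃ c : Fin k → R, t • x = ∑ j, c j • v j := by
  obtain ⟨s, hs⟩ := IsLocalization.exist_integer_multiples_of_finite m.asIdeal.primeCompl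
    (fun j => b.repr (1 ⊗ₜ x) j)
  choose c hc using hs
  have h1 : TensorProduct.mk R (Localization.AtPrime m.asIdeal) P 1 ((s : R) • x)
      = TensorProduct.mk R (Localization.AtPrime m.asIdeal) P 1 (∑ j, c j • v j) := by
    rw [map_sum, map_smul]
    simp only [map_smul, TensorProduct.mk_apply, ← hb]
    conv_lhs => rw [← b.sum_repr (1 ⊗ₜ x), Finset.smul_sum]
    refine Finset.sum_congr rfl fun j _ => ?_
    rw [← algebraMap_smul (Localization.AtPrime m.asIdeal) (c j), hc, smul_assoc]
  obtain ⟨t, ht⟩ := IsLocalizedModule.exists_of_eq (S := m.asIdeal.primeCompl) h1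
  refine ⟨t * s, (t * s).2, fun j => t * c j, ?_⟩
  rw [Submonoid.smul_def, Submonoid.smul_def, Finset.smul_sum] at ht
  simpa only [mul_smul] using ht

/-- The annihilator of x - y lies in no maximal ideal. -/
lemma eq_of_forall_prime (x y : R) (h : ∀ m : PrimeSpectrum R, ∃ t ∉ m.asIdeal, t * x = t * y) :
    x = y := by
  by_contra hne
  obtain ⟨m, hm, hle⟩ := Ideal.exists_le_maximal
    (LinearMap.ker (LinearMap.toSpanSingleton R R (x - y))) (by
      intro h
      apply hne
      have : (1 : R) ∈ LinearMap.ker (LinearMap.toSpanSingleton R R (x - y)) := by rw [h]; trivial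
      simpa [sub_eq_zero] using this)
  obtain ⟨t, ht, h⟩ := h ⟨m, hm.isPrime⟩
  exact ht (hle (by simp [mul_sub, h]))

/-- Alternating maps of degree `k` which agree on local generators of length `k` are equal. -/
lemma alternating_ext_of_local {k : ℕ} (G H : P [⋀^Fin k]→ₗ[R] R)
    (h : ∀ m : PrimeSpectrum R, ∃ v : Fin k → P, (∃ t ∉ m.asIdeal, t * G v = t * H v) ∧
      ∀ x, ∃ t ∉ m.asIdeal, ∃ c : Fin k → R, t • x = ∑ j, c j • v j) : G = H := by
  ext w
  refine eq_of_forall_prime _ _ fun m => ?_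
  obtain ⟨v, ⟨t, ht, hv⟩, hx⟩ := h m
  -- After scaling by the `s i`, both maps equal the same determinant of coefficients times their
  -- value on `v`.
  choose s hs c hc using fun i => hx (w i)
  refine ⟨t * ∏ i, s i, ?_, ?_⟩
  · exact (m.asIdeal.primeCompl.mul_mem ht (Submonoid.prod_mem _ fun i _ => hs i))
  · have h1 := fun F : P [⋀^Fin k]→ₗ[R] R =>
      alternating_linearCombination F v (fun i => s i • w i) (Matrix.of c) (fun i => hc i)
    have h2 := h1 G
    have h3 := h1 H
    rw [AlternatingMap.map_smul_univ, smul_eq_mul] at h2 h3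
    rw [mul_assoc, mul_assoc, h2, h3]
    linear_combination (Matrix.of c).det * hv

/-- The denominators of a basis of the localization are units there, so multiplying by them leaves a
basis, now consisting of images of elements of `P`. -/
lemma exists_local_basis [Module.Finite R P] [Module.Projective R P] {k : ℕ}
    (hr : Module.rankAtStalk (R := R) P = k) (m : PrimeSpectrum R) :
    ∃ (v : Fin k → P) (b : Module.Basis (Fin k) (Localization.AtPrime m.asIdeal)
      (Localization.AtPrime m.asIdeal ⊗[R] P)), ∀ i, b i = 1 ⊗ₜ v i := by
  have hf := Module.rankAtStalk_eq_finrank_tensorProduct (M := P) m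
  rw [hr] at hf
  have : Module.Free (Localization.AtPrime m.asIdeal)
      (Localization.AtPrime m.asIdeal ⊗[R] P) := Module.free_of_flat_of_isLocalRing
  let b := Module.finBasisOfFinrankEq _ _ hf.symm
  choose x hx using fun i => IsLocalizedModule.surj m.asIdeal.primeCompl
    (TensorProduct.mk R (Localization.AtPrime m.asIdeal) P 1) (b i)
  have hu : ∀ i, IsUnit (algebraMap R (Localization.AtPrime m.asIdeal) (x i).2) := fun i =>
    IsLocalization.map_units _ (x i).2
  refine ⟨fun i => (x i).1, b.isUnitSMul hu, fun i => ?_⟩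
  rw [Module.Basis.isUnitSMul_apply, algebraMap_smul]
  exact hx i

lemma exists_local_generators [Module.Finite R P] [Module.Projective R P] {k : ℕ}
    (hr : Module.rankAtStalk (R := R) P = k) (m : PrimeSpectrum R) :
    ∃ v : Fin k → P, ∀ x, ∃ t ∉ m.asIdeal, ∃ c : Fin k → R, t • x = ∑ j, c j • v j := by
  obtain ⟨v, b, hb⟩ := exists_local_basis hr m
  exact ⟨v, exists_smul_eq_sum m v b hb⟩

/-- Alternating maps of top degree are invariant under `SL(P)`. -/
lemma alternating_comp_SL [Module.Finite R P] [Module.Projective R P] {k : ℕ}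
    (hr : Module.rankAtStalk (R := R) P = k) (G : P [⋀^Fin k]→ₗ[R] R) {φ : P ≃ₗ[R] P}
    (hφ : φ ∈ SL R P) : G.compLinearMap φ.toLinearMap = G := by
  refine alternating_ext_of_local _ _ fun m => ?_
  obtain ⟨v, b, hb⟩ := exists_local_basis hr m
  have hx := exists_smul_eq_sum m v b hb
  refine ⟨v, ?_, hx⟩
  choose s hs c hc using fun i => hx (φ (v i))
  have h1 := alternating_linearCombination G v (fun i => s i • φ (v i)) (Matrix.of c) hc
  rw [AlternatingMap.map_smul_univ, smul_eq_mul] at h1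
  let A := Localization.AtPrime m.asIdeal
  have hu : ∀ i, IsUnit (algebraMap R A (s i)) := fun i =>
    IsLocalization.map_units A (⟨s i, hs i⟩ : m.asIdeal.primeCompl)
  -- Over the local ring, s i · φ(v i) = ∑ c i j v j says that the matrix `c` is diag(s) times the
  -- transposed matrix of `φ`, which has determinant 1.
  have h2 : algebraMap R A (Matrix.of c).det = algebraMap R A (∏ i, s i) := by
    have hd := hφ m
    rw [← LinearMap.det_toMatrix b] at hd
    have e : (Matrix.of c).map (algebraMap R A)
        = Matrix.diagonal (fun i => algebraMap R A (s i)) *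
          (LinearMap.toMatrix b b (φ.toLinearMap.baseChange A)).transpose := by
      ext i j
      rw [Matrix.diagonal_mul, Matrix.transpose_apply, LinearMap.toMatrix_apply, hb,
        LinearMap.baseChange_tmul, ← smul_eq_mul, ← Finsupp.smul_apply, ← map_smul,
        TensorProduct.smul_tmul', smul_eq_mul, mul_one]
      have h4 : (algebraMap R A (s i)) ⊗ₜ[R] φ.toLinearMap (v i)
          = ∑ j, algebraMap R A (c i j) • b j := by
        have h5 : (algebraMap R A (s i)) ⊗ₜ[R] φ.toLinearMap (v i) = 1 ⊗ₜ (s i • φ (v i)) := by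
          rw [Algebra.algebraMap_eq_smul_one, TensorProduct.smul_tmul]
          rfl
        rw [h5, hc, TensorProduct.tmul_sum]
        refine Finset.sum_congr rfl fun j _ => ?_
        rw [hb, TensorProduct.tmul_smul, algebraMap_smul]
      rw [h4, b.repr_sum_self]
      rfl
    rw [RingHom.map_det, RingHom.mapMatrix_apply, e, Matrix.det_mul, Matrix.det_transpose, hd,
      Matrix.det_diagonal, mul_one, map_prod]
  obtain ⟨t, ht⟩ := (IsLocalization.eq_iff_exists m.asIdeal.primeCompl A).1 h2
  refine ⟨t * ∏ i, s i, ?_, ?_⟩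
  · exact m.asIdeal.primeCompl.mul_mem t.2 (Submonoid.prod_mem _ fun i _ => hs i)
  · have h6 : G.compLinearMap φ.toLinearMap v = G (fun i => φ (v i)) := rfl
    rw [h6, mul_assoc, h1, ← mul_assoc, ht]

end TopDegree

/-! ### Determinants of direct sums and of conjugates -/

section SLConj

variable {R : Type*} [CommRing R] {P : Type*} [AddCommGroup P] [Module R P]
  {Q : Type*} [AddCommGroup Q] [Module R Q]

lemma conj_mem_SL (e : P ≃ₗ[R] Q) {φ : P ≃ₗ[R] P} (hφ : φ ∈ SL R P) :
    e.symm ≪≫ₗ φ ≪≫ₗ e ∈ SL R Q := by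
  intro m
  have h := LinearMap.det_conj (φ.toLinearMap.baseChange (Localization.AtPrime m.asIdeal))
    (e.baseChange R (Localization.AtPrime m.asIdeal) P Q)
  rw [hφ m] at h
  rw [← h]
  congr 1
  ext x
  simp

lemma prodCongr_refl_mem_SL [Module.Finite R P] [Module.Projective R P] [Module.Finite R Q]
    [Module.Projective R Q] {φ : P ≃ₗ[R] P} (hφ : φ ∈ SL R P) :
    φ.prodCongr (LinearEquiv.refl R Q) ∈ SL R (P × Q) := by
  intro m
  let A := Localization.AtPrime m.asIdeal
  have : Module.Free A (A ⊗[R] P) := Module.free_of_flat_of_isLocalRing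
  have : Module.Free A (A ⊗[R] Q) := Module.free_of_flat_of_isLocalRing
  have h := LinearMap.det_conj ((φ.prodCongr (LinearEquiv.refl R Q)).toLinearMap.baseChange A)
    (TensorProduct.prodRight R A A P Q)
  rw [← h]
  have e : (TensorProduct.prodRight R A A P Q).toLinearMap ∘ₗ
      ((φ.prodCongr (LinearEquiv.refl R Q)).toLinearMap.baseChange A) ∘ₗ
        (TensorProduct.prodRight R A A P Q).symm.toLinearMap
      = (φ.toLinearMap.baseChange A).prodMap LinearMap.id := by
    rw [← LinearMap.comp_assoc]
    refine (LinearEquiv.comp_toLinearMap_symm_eq _ _).2 ?_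
    ext x <;> simp
  rw [e, LinearMap.det_prodMap, hφ m, LinearMap.det_id, mul_one]

end SLConj

/-! ### Unimodular elements of modules of large rank -/

section StableRange

variable {R : Type*} [CommRing R]

/-- The module `N` has a linear form that is nonzero at any given prime. -/
def HasLocalForms (R : Type*) [CommRing R] (N : Type*) [AddCommGroup N] [Module R N] : Prop :=
  ∀ q : Ideal R, q.IsPrime → ∃ s : N →ₗ[R] R, ∃ x, s x ∉ q

/-- Every linear form on `N` can be changed by a multiple of `b` so that all primes which contain
its image, but not `b`, have height at least `n`. -/
def CanRaiseHeight (R : Type*) [CommRing R] (N : Type*) [AddCommGroup N] [Module R N]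
    (n : ℕ) : Prop :=
  ∀ (α : N →ₗ[R] R) (b : R), ∃ s : N →ₗ[R] R, ∀ q : Ideal R, q.IsPrime →
    (∀ x, α x + b * s x ∈ q) → b ∉ q → (n : ℕ∞) ≤ q.height

lemma hasLocalForms_self : HasLocalForms R R := fun q hq =>
  ⟨LinearMap.id, 1, fun h => hq.ne_top ((Ideal.eq_top_iff_one q).2 h)⟩

variable {N : Type*} [AddCommGroup N] [Module R N] {N' : Type*} [AddCommGroup N'] [Module R N']

/-- Prime avoidance: if the intersection of the other primes lay in `p`, one of them would, against
incomparability. -/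
lemma exists_mem_others {S : Set (Ideal R)} (hS : S.Finite) (hprime : ∀ p ∈ S, p.IsPrime)
    (hinc : ∀ p ∈ S, ∀ p' ∈ S, p' ≤ p → p' = p) (p : Ideal R) (hp : p ∈ S) :
    ∃ t ∉ p, ∀ p' ∈ S, p' ≠ p → t ∈ p' := by
  classical
  have hpp := hprime p hp
  have h : ¬ (hS.toFinset.erase p).inf id ≤ p := by
    intro h
    obtain ⟨p', hp', hle⟩ := (Ideal.IsPrime.inf_le' hpp).1 h
    rw [Finset.mem_erase, Set.Finite.mem_toFinset] at hp'
    exact hp'.1 (hinc p hp p' hp'.2 hle)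
  obtain ⟨t, ht, htp⟩ := SetLike.not_le_iff_exists.1 h
  refine ⟨t, htp, fun p' hp' hne => ?_⟩
  have : (hS.toFinset.erase p).inf id ≤ p' :=
    Finset.inf_le (f := id) (Finset.mem_erase.2 ⟨hne, hS.mem_toFinset.2 hp'⟩)
  exact this ht

/-- A linear form can be changed by a multiple of `b` to be nonzero at finitely many incomparable
primes which do not contain `b`. -/
lemma exists_form_avoiding (hN : HasLocalForms R N) {S : Set (Ideal R)} (hS : S.Finite)
    (hprime : ∀ p ∈ S, p.IsPrime) (hinc : ∀ p ∈ S, ∀ p' ∈ S, p' ≤ p → p' = p) (b : R)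
    (hb : ∀ p ∈ S, b ∉ p) (α : N →ₗ[R] R) :
    ∃ s : N →ₗ[R] R, ∀ p ∈ S, ∃ x, α x + b * s x ∉ p := by
  classical
  choose t ht ht' using exists_mem_others hS hprime hinc
  have h1 : ∀ p : Ideal R, ∃ s : N →ₗ[R] R, p.IsPrime → ∃ x, s x ∉ p := fun p => by
    by_cases h : p.IsPrime
    · obtain ⟨s, hs⟩ := hN p h
      exact ⟨s, fun _ => hs⟩
    · exact ⟨0, fun h' => absurd h' h⟩
  choose f hf using h1
  -- Only primes containing the image of α need a correction: `T p` is zero at the others. Modulo p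
  -- all summands but the one indexed by p vanish, so the corrections do not interfere.
  let T : Ideal R → R := fun p => if h : p ∈ S ∧ ∀ x, α x ∈ p then t p h.1 else 0
  have hT : ∀ p ∈ S, ∀ p', p' ≠ p → T p' ∈ p := by
    intro p hp p' hne
    simp only [T]
    split_ifs with h
    · exact ht' p' h.1 p hp hne.symm
    · exact p.zero_mem
  refine ⟨∑ p ∈ hS.toFinset, T p • f p, fun p hp => ?_⟩
  have hpp := hprime p hp
  have hsum : ∀ x, (∑ p ∈ hS.toFinset, T p • f p) x - T p * f p x ∈ p := by
    intro x
    rw [← Finset.add_sum_erase _ _ (hS.mem_toFinset.2 hp)]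
    simp only [LinearMap.add_apply, LinearMap.smul_apply, smul_eq_mul, add_sub_cancel_left,
      LinearMap.sum_apply]
    exact Ideal.sum_mem _ fun p' hp' => p.mul_mem_right _ (hT p hp p' (Finset.ne_of_mem_erase hp'))
  by_cases hα : ∀ x, α x ∈ p
  · obtain ⟨x, hx⟩ := hf p hpp
    refine ⟨x, fun h => ?_⟩
    have h2 : b * (T p * f p x) ∈ p := by
      have h3 := p.sub_mem (p.sub_mem h (hα x)) (p.mul_mem_left b (hsum x))
      convert h3 using 1
      ring
    have h4 : T p = t p hp := dif_pos ⟨hp, hα⟩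
    rw [h4] at h2
    rcases hpp.mem_or_mem h2 with h | h
    · exact hb p hp h
    · rcases hpp.mem_or_mem h with h | h
      · exact ht p hp h
      · exact hx h
  · push Not at hα
    obtain ⟨x, hx⟩ := hα
    have h4 : T p = 0 := dif_neg fun h => hx (h.2 x)
    refine ⟨x, fun h => hx ?_⟩
    have h5 := hsum x
    rw [h4, zero_mul, sub_zero] at h5
    simpa using p.sub_mem h (p.mul_mem_left b h5)

/-- Avoid the finitely many minimal primes of `J` that do not contain `b`. A prime over `J` that
contains the new image but not `b` lies over one of them, and strictly, so its height is at least
one larger. -/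
lemma exists_form_height_succ [IsNoetherianRing R] (hN : HasLocalForms R N) (J : Ideal R) (n : ℕ)
    (b : R) (hJ : ∀ q : Ideal R, q.IsPrime → J ≤ q → b ∉ q → (n : ℕ∞) ≤ q.height)
    (α : N →ₗ[R] R) :
    ∃ s : N →ₗ[R] R, ∀ q : Ideal R, q.IsPrime → J ≤ q → (∀ x, α x + b * s x ∈ q) → b ∉ q →
      ((n + 1 : ℕ) : ℕ∞) ≤ q.height := by
  obtain ⟨s, hs⟩ := exists_form_avoiding hN (S := {p ∈ J.minimalPrimes | b ∉ p})
    ((Ideal.finite_minimalPrimes_of_isNoetherianRing R J).subset (Set.sep_subset _ _))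
    (fun p hp => hp.1.1.1) (fun p hp p' hp' hle => le_antisymm hle (hp.1.2 hp'.1.1 hle)) b
    (fun p hp => hp.2) α
  refine ⟨s, fun q hq hJq hxq hbq => ?_⟩
  obtain ⟨p, hp, hpq⟩ := Ideal.exists_minimalPrimes_le hJq
  have hpp : p.IsPrime := hp.1.1
  have hbp : b ∉ p := fun h => hbq (hpq h)
  obtain ⟨x, hx⟩ := hs p ⟨hp, hbp⟩
  have hlt : p < q := lt_of_le_of_ne hpq fun h => hx (h ▸ hxq x)
  have h1 := Ideal.height_add_one_le_of_lt_of_isPrime hlt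
  have h2 := hJ p hpp hp.1.2 hbp
  push_cast
  exact (add_le_add_left h2 1).trans h1

lemma canRaiseHeight_one [IsNoetherianRing R] (hN : HasLocalForms R N) :
    CanRaiseHeight R N 1 := by
  intro α b
  obtain ⟨s, hs⟩ := exists_form_height_succ hN ⊥ 0 b (fun _ _ _ _ => by simp) α
  exact ⟨s, fun q hq h hb => hs q hq bot_le h hb⟩

/-- Correct the form on `N` first; then correct it on `N'` relative to the ideal generated on `N`,
which gains one in height. -/
lemma CanRaiseHeight.prod [IsNoetherianRing R] {n : ℕ} (h : CanRaiseHeight R N n)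
    (hN' : HasLocalForms R N') : CanRaiseHeight R (N × N') (n + 1) := by
  intro α b
  obtain ⟨s, hs⟩ := h (α ∘ₗ LinearMap.inl R N N') b
  let β := α ∘ₗ LinearMap.inl R N N' + b • s
  obtain ⟨s', hs'⟩ := exists_form_height_succ hN' (LinearMap.range β) n b
    (fun q hq hle hb => hs q hq (fun x => hle ⟨x, rfl⟩) hb) (α ∘ₗ LinearMap.inr R N N')
  refine ⟨s.coprod s', fun q hq hx hb => hs' q hq ?_ ?_ hb⟩
  · rintro _ ⟨x, rfl⟩
    simpa [β] using hx (x, 0)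
  · intro y
    simpa using hx (0, y)

lemma CanRaiseHeight.congr {n : ℕ} (h : CanRaiseHeight R N n) (e : N ≃ₗ[R] N') :
    CanRaiseHeight R N' n := by
  intro α b
  obtain ⟨s, hs⟩ := h (α ∘ₗ e.toLinearMap) b
  refine ⟨s ∘ₗ e.symm.toLinearMap, fun q hq hx hb => hs q hq (fun x => ?_) hb⟩
  simpa using hx (e x)

lemma CanRaiseHeight.mono {n m : ℕ} (h : CanRaiseHeight R N n) (hm : m ≤ n) :
    CanRaiseHeight R N m := fun α b => by
  obtain ⟨s, hs⟩ := h α b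
  exact ⟨s, fun q hq hx hb => le_trans (by exact_mod_cast hm) (hs q hq hx hb)⟩

/-- `(N ⊕ Rᵏ) ⊕ R ≅ N ⊕ Rᵏ⁺¹`. -/
def snocEquiv (R : Type*) [CommRing R] (N : Type*) [AddCommGroup N] [Module R N] (k : ℕ) :
    ((N × (Fin k → R)) × R) ≃ₗ[R] N × (Fin (k + 1) → R) where
  toFun x := (x.1.1, Fin.snoc (α := fun _ => R) x.1.2 x.2)
  invFun y := ((y.1, Fin.init (α := fun _ => R) y.2), y.2 (Fin.last k))
  map_add' x y := by
    refine Prod.ext rfl (funext fun i => ?_)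
    induction i using Fin.lastCases <;> simp
  map_smul' c x := by
    refine Prod.ext rfl (funext fun i => ?_)
    induction i using Fin.lastCases <;> simp
  left_inv x := by simp
  right_inv y := by simp

lemma canRaiseHeight_free [IsNoetherianRing R] (hN : HasLocalForms R N) (k : ℕ) :
    CanRaiseHeight R (N × (Fin k → R)) (k + 1) := by
  induction k with
  | zero =>
    refine (canRaiseHeight_one hN).congr (LinearEquiv.symm ?_)
    exact LinearEquiv.prodUnique
  | succ k ih => exact (ih.prod hasLocalForms_self).congr (snocEquiv R N k)

/-- Height d + 1 exceeds the dimension, so a maximal ideal over the image would contain `b`, hence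
also the image of α, against unimodularity of (α, b). -/
lemma exists_surjective_of_canRaiseHeight {d : ℕ} (hd : ringKrullDim R ≤ d)
    (h : CanRaiseHeight R N (d + 1)) (α : N →ₗ[R] R) (b : R)
    (hu : ∀ q : Ideal R, q.IsPrime → (∀ x, α x ∈ q) → b ∉ q) :
    ∃ s : N →ₗ[R] R, Function.Surjective (α + b • s) := by
  obtain ⟨s, hs⟩ := h α b
  refine ⟨s, LinearMap.range_eq_top.1 ?_⟩
  by_contra hne
  obtain ⟨q, hq, hle⟩ := Ideal.exists_le_maximal (LinearMap.range (α + b • s)) hne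
  have hqp := hq.isPrime
  have hx : ∀ x, α x + b * s x ∈ q := fun x => hle ⟨x, rfl⟩
  by_cases hb : b ∈ q
  · refine hu q hqp (fun x => ?_) hb
    simpa using q.sub_mem (hx x) (q.mul_mem_right (s x) hb)
  · have h1 := hs q hqp hx hb
    have h2 := (Ideal.height_le_ringKrullDim_of_isPrime (I := q)).trans hd
    have h3 : ((d + 1 : ℕ) : WithBot ℕ∞) ≤ (d : WithBot ℕ∞) :=
      le_trans (by exact_mod_cast h1) h2
    have h4 : d + 1 ≤ d := by exact_mod_cast h3
    omega

/-! ### Transitivity of `SL` on unimodular forms by transvections -/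

lemma transvection_shear {M : Type*} [AddCommGroup M] [Module R M] {a b : Um R M}
    {f : Module.Dual R M} {x : M} (h : f x = 0)
    (hab : ∀ y, b.1 y = a.1 (y + f y • x)) : ∃ φ ∈ SL R M, b = a.comp φ :=
  ⟨LinearEquiv.transvection h, transvection_mem_SL h, Subtype.ext (LinearMap.ext hab)⟩

lemma actsTransitively_of_base {M : Type*} [AddCommGroup M] [Module R M]
    {G : Subgroup (M ≃ₗ[R] M)} (c : Um R M) (h : ∀ a, (orbitRel G) a c) :
    ActsTransitivelyOnUm G := fun a b =>
  (orbitRel G).iseqv.trans (h a) ((orbitRel G).iseqv.symm (h b))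

/-- Transitivity of `SL(N ⊕ R)` on `Um(N ⊕ R)` if `N` is large compared to the dimension. -/
lemma actsTransitively_of_canRaiseHeight {d : ℕ} (hd : ringKrullDim R ≤ d)
    (h : CanRaiseHeight R N (d + 1)) : ActsTransitivelyOnUm (SL R (N × R)) := by
  refine actsTransitively_of_base ⟨LinearMap.snd R N R, LinearMap.snd_surjective⟩ fun a => ?_
  have ha : ∀ x r, a.1 (x, r) = a.1 (x, 0) + r * a.1 (0, 1) := fun x r => by
    rw [← smul_eq_mul, ← map_smul, ← map_add]
    simp
  obtain ⟨s, hs⟩ := exists_surjective_of_canRaiseHeight hd h (a.1 ∘ₗ LinearMap.inl R N R)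
    (a.1 (0, 1)) (fun q hq hx hb => by
      obtain ⟨⟨x, r⟩, hy⟩ := a.2 1
      apply hq.ne_top
      rw [Ideal.eq_top_iff_one, ← hy, ha]
      exact q.add_mem (hx x) (q.mul_mem_left _ hb))
  set b := a.1 (0, 1) with hb
  set β := a.1 ∘ₗ LinearMap.inl R N R + b • s with hβ
  have hβ' : ∀ x, β x = a.1 (x, 0) + b * s x := fun x => rfl
  -- The chain of shears is (α, b) → (β, b) → (β, 1) → (0, 1). The middle one adds β(x₀) = 1 - b to
  -- the last entry, which is possible because β alone is already surjective.
  obtain ⟨x₀, hx₀⟩ := hs (1 - b)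
  let a₁ : Um R (N × R) := ⟨β.coprod (LinearMap.toSpanSingleton R R b), fun r => by
    obtain ⟨x, hx⟩ := hs r
    exact ⟨(x, 0), by simp [hx]⟩⟩
  let a₂ : Um R (N × R) := ⟨β.coprod LinearMap.id, fun r => ⟨(0, r), by simp⟩⟩
  have h1 : (orbitRel (SL R (N × R))) a a₁ :=
    transvection_shear (f := s ∘ₗ LinearMap.fst R N R) (x := ((0, 1) : N × R)) (by simp) (by
      rintro ⟨x, r⟩
      simp only [a₁, LinearMap.coprod_apply, hβ', LinearMap.toSpanSingleton_apply, smul_eq_mul,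
        LinearMap.comp_apply, LinearMap.fst_apply, map_add, map_smul, ← hb]
      rw [ha x r]
      ring)
  have h2 : (orbitRel (SL R (N × R))) a₁ a₂ :=
    transvection_shear (f := LinearMap.snd R N R) (x := ((x₀, 0) : N × R)) (by simp) (by
      rintro ⟨x, r⟩
      simp only [a₁, a₂, LinearMap.coprod_apply, LinearMap.toSpanSingleton_apply, smul_eq_mul,
        LinearMap.snd_apply, map_add, map_smul, hx₀, LinearMap.id_apply, zero_mul]
      ring)
  have h3 : (orbitRel (SL R (N × R))) a₂ ⟨LinearMap.snd R N R, LinearMap.snd_surjective⟩ :=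
    transvection_shear (f := -(β ∘ₗ LinearMap.fst R N R)) (x := ((0, 1) : N × R)) (by simp) (by
      rintro ⟨x, r⟩
      simp [a₂])
  exact (orbitRel _).iseqv.trans h1 ((orbitRel _).iseqv.trans h2 h3)

lemma ActsTransitivelyOnUm.congr {M M' : Type*} [AddCommGroup M] [Module R M] [AddCommGroup M']
    [Module R M'] (e : M ≃ₗ[R] M') (h : ActsTransitivelyOnUm (SL R M)) :
    ActsTransitivelyOnUm (SL R M') := by
  intro a b
  obtain ⟨φ, hφ, hab⟩ := h ⟨a.1 ∘ₗ e.toLinearMap, a.2.comp e.surjective⟩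
    ⟨b.1 ∘ₗ e.toLinearMap, b.2.comp e.surjective⟩
  refine ⟨_, conj_mem_SL e hφ, Subtype.ext (LinearMap.ext fun x => ?_)⟩
  have := congrArg (fun c : Um R M => c.1 (e.symm x)) hab
  simpa [Um.comp] using this

end StableRange

/-! ### Splitting off hyperbolic planes -/

section Reduction

variable {R : Type u} [CommRing R]

lemma rank_add {P : Type*} [AddCommGroup P] [Module R P] [Module.Finite R P]
    [Module.Projective R P] {Q : Type*} [AddCommGroup Q] [Module R Q] [Module.Finite R Q]
    [Module.Projective R Q] {k l : ℕ} (hP : Module.rankAtStalk (R := R) P = k)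
    (hQ : Module.rankAtStalk (R := R) Q = l) :
    Module.rankAtStalk (R := R) (P × Q) = (k + l : ℕ) := by
  rw [Module.rankAtStalk_prod, hP, hQ]
  push_cast
  rfl

lemma rank_free (k : ℕ) : Module.rankAtStalk (R := R) (Fin k → R) = k := by
  funext p
  have : Nontrivial R := ⟨0, 1, fun h => p.isPrime.ne_top ((Ideal.eq_top_iff_one _).2
    (h ▸ p.asIdeal.zero_mem))⟩
  rw [Module.rankAtStalk_eq_finrank_of_free]
  simp

lemma rank_plane : Module.rankAtStalk (R := R) (R × R) = (2 : ℕ) := by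
  funext p
  have : Nontrivial R := ⟨0, 1, fun h => p.isPrime.ne_top ((Ideal.eq_top_iff_one _).2
    (h ▸ p.asIdeal.zero_mem))⟩
  rw [Module.rankAtStalk_eq_finrank_of_free]
  simp

/-! ### Pfaffians of forms and the splitting of a hyperbolic plane -/

namespace AltIso

variable {P : Type*} [AddCommGroup P] [Module R P] {Q : Type*} [AddCommGroup Q] [Module R Q]

/-- The Pfaffian of `f` in degree `2n`. -/
def pf (f : AltIso R P) (n : ℕ) : P [⋀^Fin (2 * n)]→ₗ[R] R := pfMap f.form f.alt n

lemma pf_pullback (h : P ≃ₗ[R] Q) (f : AltIso R Q) (n : ℕ) :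
    (f.pullback h).pf n = (f.pf n).compLinearMap h.toLinearMap := by
  ext v
  exact pfMap_comp _ _ _ _ _ _ fun i j => rfl

lemma pf_pullback_eq_iff (h : P ≃ₗ[R] Q) (f g : AltIso R Q) (n : ℕ) :
    (f.pullback h).pf n = (g.pullback h).pf n ↔ f.pf n = g.pf n := by
  constructor
  · intro hfg
    ext v
    have := congrArg (fun F => F fun i => h.symm (v i)) hfg
    simpa [pf_pullback] using this
  · intro hfg
    rw [pf_pullback, pf_pullback, hfg]

lemma pf_pullback_SL [Module.Finite R P] [Module.Projective R P] {n : ℕ}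
    (hr : Module.rankAtStalk (R := R) P = (2 * n : ℕ)) (f : AltIso R P) {φ : P ≃ₗ[R] P}
    (hφ : φ ∈ SL R P) : (f.pullback φ).pf n = f.pf n := by
  rw [pf_pullback, alternating_comp_SL hr _ hφ]

/-- Evaluate on the hyperbolic pair followed by vectors of `P`: the plane contributes the factor 1.
-/
lemma pf_of_perp_psi2 {n : ℕ} {f g : AltIso R P}
    (h : (f.perp (psi2 R)).pf (n + 1) = (g.perp (psi2 R)).pf (n + 1)) : f.pf n = g.pf n := by
  have key : ∀ (f : AltIso R P) (v : Fin (2 * n) → P), (f.perp (psi2 R)).pf (n + 1)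
      (Fin.cons (0, (1, 0)) (Fin.cons (0, (0, 1)) (fun i => (v i, 0)) :
        Fin (2 * n + 1) → P × (R × R)) : Fin (2 * n + 2) → P × (R × R)) = f.pf n v := by
    intro f v
    refine (pfMap_cons_cons _ _ _ _ _ (by simp)).trans ?_
    rw [perp_apply]
    simp only [map_zero, psi2_apply, mul_one, mul_zero, sub_zero, zero_add, one_mul]
    exact pfMap_comp _ _ _ _ _ _ fun i j => by simp
  ext v
  rw [← key f, h, key]

lemma pullback_pullback {M : Type*} [AddCommGroup M] [Module R M] (h : P ≃ₗ[R] Q)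
    (k : Q ≃ₗ[R] M) (f : AltIso R M) : (f.pullback k).pullback h = f.pullback (h ≪≫ₗ k) := rfl

/-- The restriction of a form to an orthogonal summand. -/
def ofPerp (f : AltIso R (P × Q)) (h : ∀ p q, f.form (p, 0) (0, q) = 0) : AltIso R P where
  form := f.form.compl₁₂ (LinearMap.inl R P Q) (LinearMap.inl R P Q)
  alt p := f.alt _
  bij := by
    have h' : ∀ p q, f.form (0, q) (p, 0) = 0 := fun p q => by
      rw [alt_swap f.alt, h, neg_zero]
    constructor
    · intro p p' hp
      have : f.form (p, 0) = f.form (p', 0) := by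
        ext x
        · exact LinearMap.congr_fun hp x
        · simp [h]
      exact congrArg Prod.fst (f.bij.1 this)
    · intro l
      obtain ⟨⟨p, q⟩, hpq⟩ := f.bij.2 (l ∘ₗ LinearMap.fst R P Q)
      refine ⟨p, ?_⟩
      ext x
      have h1 := LinearMap.congr_fun hpq (x, 0)
      have h2 : ((p, q) : P × Q) = (p, 0) + (0, q) := by simp
      rw [h2, map_add, LinearMap.add_apply, h', add_zero] at h1
      exact h1

lemma form_prod (f : AltIso R (P × Q)) (x y : P × Q) :
    f.form x y = f.form (x.1, 0) (y.1, 0) + f.form (x.1, 0) (0, y.2)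
      + f.form (0, x.2) (y.1, 0) + f.form (0, x.2) (0, y.2) := by
  have e : ∀ z : P × Q, z = (z.1, 0) + (0, z.2) := fun z => by simp
  conv_lhs => rw [e x, e y]
  simp only [map_add, LinearMap.add_apply]
  ring

/-- A form whose last vector is paired to `Um(Q ⊕ R)` splits off a hyperbolic plane, if `SL(Q ⊕ R)`
acts transitively. -/
lemma exists_pullback_eq_perp_psi2 [Module.Finite R Q] [Module.Projective R Q]
    (htr : ActsTransitivelyOnUm (SL R (Q × R))) (f : AltIso R (Q × (R × R))) :
    ∃ φ ∈ SL R (Q × (R × R)), ∃ f' : AltIso R Q, f.pullback φ = f'.perp (psi2 R) := by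
  let j : Q × R →ₗ[R] Q × (R × R) := LinearMap.prodMap LinearMap.id (LinearMap.inl R R R)
  have hj : ∀ q r, j (q, r) = (q, (r, 0)) := fun q r => rfl
  let e₄ : Q × (R × R) := (0, (0, 1))
  -- By non-degeneracy some vector pairs to 1 with `e₄`. Its `e₄`-component contributes nothing
  -- because f(e₄, e₄) = 0, so the pairing is already onto on Q ⊕ R.
  let a : Um R (Q × R) := ⟨f.form.flip e₄ ∘ₗ j, by
    obtain ⟨⟨q, r, t⟩, hy⟩ := f.bij.2 (LinearMap.snd R R R ∘ₗ LinearMap.snd R Q (R × R))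
    have h1 := LinearMap.congr_fun hy e₄
    have h2 : ((q, r, t) : Q × (R × R)) = j (q, r) + t • e₄ := by simp [hj, e₄]
    rw [h2, map_add, map_smul, LinearMap.add_apply, LinearMap.smul_apply, f.alt] at h1
    have h3 : f.form (j (q, r)) e₄ = 1 := by simpa [e₄] using h1
    intro c
    exact ⟨c • (q, r), (map_smul _ c (q, r)).trans (by
      change c • f.form (j (q, r)) e₄ = c
      rw [h3, smul_eq_mul, mul_one])⟩⟩
  -- After this change of coordinates `e₄` is orthogonal to Q and pairs to 1 with `e₃`.
  obtain ⟨σ, hσ, hσa⟩ := htr a ⟨LinearMap.snd R Q R, LinearMap.snd_surjective⟩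
  have hσa' : ∀ x : Q × R, f.form (j (σ x)) e₄ = x.2 := fun x =>
    (congrArg (fun c : Um R (Q × R) => c.1 x) hσa).symm
  let φ₁ := (LinearEquiv.prodAssoc R Q R R).symm ≪≫ₗ (σ.prodCongr (LinearEquiv.refl R R)) ≪≫ₗ
    LinearEquiv.prodAssoc R Q R R
  have hφ₁ : φ₁ ∈ SL R (Q × (R × R)) := conj_mem_SL _ (prodCongr_refl_mem_SL hσ)
  have h₁ : ∀ q r t, φ₁ (q, (r, t)) = j (σ (q, r)) + t • e₄ := fun q r t => by
    simp [φ₁, hj, e₄, LinearEquiv.prodAssoc, j]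
  set f₁ := f.pullback φ₁ with hf₁
  have hf₁e : ∀ q r, f₁.form (q, (r, 0)) e₄ = r := fun q r => by
    rw [hf₁, pullback_apply, h₁, show e₄ = ((0 : Q), ((0 : R), (1 : R))) from rfl, h₁]
    simp only [show ((0 : Q), (0 : R)) = 0 from rfl, map_zero, zero_add, zero_smul, add_zero,
      one_smul]
    exact hσa' (q, r)
  let e₃ : Q × (R × R) := (0, (1, 0))
  have h00 : f₁.form (0, 0) = 0 := map_zero _
  -- Only orthogonality of Q to `e₃` is still missing. The transvection q ↦ q + f₁(q, e₃)e₄ achieves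
  -- it since f₁(e₄, e₃) = -1, and it preserves the pairings with `e₄`.
  let c : Module.Dual R (Q × (R × R)) :=
    f₁.form.flip e₃ ∘ₗ LinearMap.inl R Q (R × R) ∘ₗ LinearMap.fst R Q (R × R)
  have hc : c e₄ = 0 := by simp [c, e₄, h00]
  have h₂ : ∀ x, LinearEquiv.transvection hc x = x + f₁.form (x.1, 0) e₃ • e₄ := fun x => rfl
  set f₂ := f₁.pullback (LinearEquiv.transvection hc) with hf₂
  have he₄₃ : f₁.form e₄ e₃ = -1 := by rw [alt_swap f₁.alt, hf₁e 0 1]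
  have hf₁0 : ∀ q, f₁.form (q, 0) e₄ = 0 := fun q => hf₁e q 0
  have hq₃ : ∀ q, f₂.form (q, 0) e₃ = 0 := fun q => by
    rw [hf₂, pullback_apply, h₂, h₂]
    have h4 : f₁.form (e₃.1, 0) e₃ = 0 := by simp [e₃, h00]
    rw [h4, zero_smul, add_zero, map_add, map_smul, LinearMap.add_apply, LinearMap.smul_apply,
      he₄₃, smul_eq_mul, mul_neg, mul_one, add_neg_cancel]
  have hq₄ : ∀ q, f₂.form (q, 0) e₄ = 0 := fun q => by
    rw [hf₂, pullback_apply, h₂, h₂]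
    have : f₁.form (e₄.1, 0) e₃ = 0 := by simp [e₄, h00]
    rw [this, zero_smul, add_zero, map_add, map_smul, LinearMap.add_apply, LinearMap.smul_apply,
      f₁.alt, hf₁0, smul_zero, add_zero]
  have h₃₄ : f₂.form e₃ e₄ = 1 := by
    rw [hf₂, pullback_apply, h₂, h₂]
    have h3 : f₁.form (e₄.1, 0) e₃ = 0 := by simp [e₄, h00]
    rw [h3, zero_smul, add_zero, add_zero]
    exact hf₁e 0 1
  have hd : ∀ z : R × R, ((0, z) : Q × (R × R)) = z.1 • e₃ + z.2 • e₄ := fun z => by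
    simp [e₃, e₄]
  have hperp : ∀ q z, f₂.form (q, 0) (0, z) = 0 := fun q z => by
    rw [hd, map_add, map_smul, map_smul, hq₃, hq₄]
    simp
  refine ⟨φ₁ * LinearEquiv.transvection hc, Subgroup.mul_mem _ hφ₁ (transvection_mem_SL hc),
    f₂.ofPerp hperp, ?_⟩
  change f₂ = _
  ext1
  apply LinearMap.ext
  intro x
  apply LinearMap.ext
  intro y
  rw [form_prod, hperp, alt_swap f₂.alt (y.1, 0) (0, x.2), hperp, perp_apply]
  have h5 : f₂.form (0, x.2) (0, y.2) = x.2.1 * y.2.2 - x.2.2 * y.2.1 := by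
    rw [hd, hd]
    simp only [map_add, map_smul, LinearMap.add_apply, LinearMap.smul_apply, f₂.alt, h₃₄,
      alt_swap f₂.alt e₃ e₄, smul_eq_mul]
    ring
  rw [h5, neg_zero, add_zero, add_zero]
  rfl

end AltIso

/-! ### Calculation rules in `V_SL(R)` -/

namespace VSL

variable {P : Type u} [AddCommGroup P] [Module R P] [Module.Finite R P] [Module.Projective R P]
  {Q : Type u} [AddCommGroup Q] [Module R Q] [Module.Finite R Q] [Module.Projective R Q]

lemma mk_perp (g f : AltIso R P) (g' f' : AltIso R Q) :
    mk (P × Q) (g.perp g') (f.perp f') = mk P g f + mk Q g' f' := by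
  rw [mk, mk, mk, ← QuotientAddGroup.mk_add, ← sub_eq_zero, ← QuotientAddGroup.mk_sub,
    QuotientAddGroup.eq_zero_iff]
  exact AddSubgroup.subset_closure (Relation.sum P Q g f g' f')

lemma mk_add_mk (f₀ f₁ f₂ : AltIso R P) : mk P f₀ f₁ + mk P f₁ f₂ = mk P f₀ f₂ := by
  rw [mk, mk, mk, ← QuotientAddGroup.mk_add, ← sub_eq_zero, ← QuotientAddGroup.mk_sub,
    QuotientAddGroup.eq_zero_iff]
  exact AddSubgroup.subset_closure (Relation.trans P f₀ f₁ f₂)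

lemma mk_self (f : AltIso R P) : mk P f f = 0 := by
  simpa using mk_add_mk f f f

lemma mk_congr (h : P ≃ₗ[R] Q) (g f : AltIso R Q) :
    mk P (g.pullback h) (f.pullback h) = mk Q g f := by
  rw [mk, mk, gen, gen]
  congr 2
  exact Quotient.sound ⟨h, rfl, rfl⟩

/-- Stabilization by a common summand, used to enlarge modules in one inclusion and also to strip
hyperbolic planes in the other. -/
lemma mk_perp_self (g f : AltIso R P) (h : AltIso R Q) :
    mk (P × Q) (g.perp h) (f.perp h) = mk P g f := by
  rw [mk_perp, mk_self, add_zero]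

end VSL

/-- One step of the reduction: a form with the Pfaffian of `g ⊥ ψ₂` comes, in `V_SL(R)`, from a
form with the Pfaffian of `g`. -/
lemma exists_descend {Q : Type u} [AddCommGroup Q] [Module R Q] [Module.Finite R Q]
    [Module.Projective R Q] {n : ℕ} (hr : Module.rankAtStalk (R := R) Q = (2 * n : ℕ))
    (htr : ActsTransitivelyOnUm (SL R (Q × R))) (g : AltIso R Q) (f : AltIso R (Q × (R × R)))
    (hf : f.pf (n + 1) = (g.perp (AltIso.psi2 R)).pf (n + 1)) :
    ∃ f' : AltIso R Q, f'.pf n = g.pf n ∧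
      VSL.mk (Q × (R × R)) (g.perp (AltIso.psi2 R)) f = VSL.mk Q g f' := by
  obtain ⟨φ, hφ, f', hf'⟩ := f.exists_pullback_eq_perp_psi2 htr
  refine ⟨f', AltIso.pf_of_perp_psi2 ?_, ?_⟩
  -- The degree 2n + 2 is the rank of Q ⊕ R², which is what makes the Pfaffian invariant under `φ`.
  · rw [← hf', AltIso.pf_pullback_SL (rank_add hr rank_plane) _ hφ, hf]
  · rw [← VSL.mk_pullback _ _ f φ hφ, hf', VSL.mk_perp_self]

end Reduction

/-! ### Forms on `P₀ ⊕ R²ⁿ` with the standard Pfaffian are generalized Vaserstein symbols -/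

section Surjective

variable {R : Type u} [CommRing R]

lemma psi_form_succ (n : ℕ) (x y : Fin (2 * n + 2) → R) :
    (AltIso.psi R (n + 1)).form x y = x 0 * y 1 - x 1 * y 0
      + (AltIso.psi R n).form (fun i => x i.succ.succ) (fun i => y i.succ.succ) := by
  change psiForm R (n + 1) x y = _ + psiForm R n _ _
  rw [psiForm_apply, psiForm_apply]
  change ∑ i : Fin (2 * n + 2), _ = _
  rw [Fin.sum_univ_succ, Fin.sum_univ_succ, ← add_assoc]
  have p0 : partner (n + 1) (0 : Fin (2 * n + 2)) = (1 : Fin (2 * n + 2)) := by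
    apply Fin.ext
    simp [partner]
  have p1 : partner (n + 1) (Fin.succ 0 : Fin (2 * n + 2)) = (0 : Fin (2 * n + 2)) := by
    apply Fin.ext
    simp [partner, Nat.mod_eq_of_lt (show 1 < 2 * (n + 1) by omega)]
  have p2 : ∀ i : Fin (2 * n), partner (n + 1) (i.succ.succ : Fin (2 * n + 2))
      = (partner n i).succ.succ := by
    intro i
    apply Fin.ext
    simp only [partner, Fin.val_succ, Nat.even_add_one, not_not]
    split_ifs with h
    · rfl
    · have : (i : ℕ) ≠ 0 := fun h0 => h (by simp [h0])
      omega
  have s0 : psiSign R (n + 1) (0 : Fin (2 * n + 2)) = 1 := by simp [psiSign]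
  have s1 : psiSign R (n + 1) (Fin.succ 0 : Fin (2 * n + 2)) = -1 := by
    simp [psiSign, Nat.mod_eq_of_lt (show 1 < 2 * (n + 1) by omega)]
  have s2 : ∀ i : Fin (2 * n), psiSign R (n + 1) (i.succ.succ : Fin (2 * n + 2))
      = psiSign R n i := fun i => by
    simp only [psiSign, Fin.val_succ, Nat.even_add_one, not_not]
  congr 1
  · rw [p0, p1, s0, s1]
    simp only [Fin.succ_zero_eq_one]
    ring
  · exact Finset.sum_congr rfl fun i _ => by rw [p2, s2]

/-- `(N ⊕ R²ⁿ) ⊕ R² ≅ N ⊕ R²ⁿ⁺²`, the last summand becoming the first coordinates. -/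
def consEquiv (R : Type*) [CommRing R] (N : Type*) [AddCommGroup N] [Module R N] (n : ℕ) :
    ((N × (Fin (2 * n) → R)) × (R × R)) ≃ₗ[R] N × (Fin (2 * (n + 1)) → R) where
  toFun x := (x.1.1, (Fin.cons x.2.1 (Fin.cons x.2.2 x.1.2 : Fin (2 * n + 1) → R) :
    Fin (2 * n + 2) → R))
  invFun y := ((y.1, fun i => y.2 (i.succ.succ : Fin (2 * n + 2))),
    (y.2 (0 : Fin (2 * n + 2)), y.2 (1 : Fin (2 * n + 2))))
  map_add' x y := by
    refine Prod.ext rfl (funext fun (i : Fin (2 * n + 2)) => ?_)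
    refine Fin.cases ?_ (fun i => Fin.cases ?_ (fun i => ?_) i) i <;> simp
  map_smul' c x := by
    refine Prod.ext rfl (funext fun (i : Fin (2 * n + 2)) => ?_)
    refine Fin.cases ?_ (fun i => Fin.cases ?_ (fun i => ?_) i) i <;> simp
  left_inv x := rfl
  right_inv y := by
    refine Prod.ext rfl (funext fun (i : Fin (2 * n + 2)) => ?_)
    refine Fin.cases ?_ (fun i => Fin.cases ?_ (fun i => ?_) i) i <;> rfl

lemma perp_psi_pullback_consEquiv {N : Type*} [AddCommGroup N] [Module R N] (g : AltIso R N)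
    (n : ℕ) : (g.perp (AltIso.psi R (n + 1))).pullback (consEquiv R N n)
      = (g.perp (AltIso.psi R n)).perp (AltIso.psi2 R) := by
  ext1
  apply LinearMap.ext
  intro x
  apply LinearMap.ext
  intro y
  rw [AltIso.pullback_apply, AltIso.perp_apply, AltIso.perp_apply, AltIso.perp_apply,
    psi_form_succ, AltIso.psi2_apply]
  change g.form x.1.1 y.1.1 + (x.2.1 * y.2.2 - x.2.2 * y.2.1 + (AltIso.psi R n).form x.1.2 y.1.2)
    = _
  ring

variable {P₀ : Type u} [AddCommGroup P₀] [Module R P₀] [Module.Finite R P₀]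
  [Module.Projective R P₀]

/-- `P₀ ⊕ R² ≅ P₀ ⊕ R^(2 * 1)`. -/
def planeEquiv (R : Type*) [CommRing R] (N : Type*) [AddCommGroup N] [Module R N] :
    (N × (R × R)) ≃ₗ[R] N × (Fin (2 * 1) → R) :=
  ((LinearEquiv.prodUnique (R := R) (M := N) (M₂ := Fin 0 → R)).symm.prodCongr
    (LinearEquiv.refl R (R × R))) ≪≫ₗ consEquiv R N 0

lemma perp_psi_pullback_planeEquiv {N : Type*} [AddCommGroup N] [Module R N] (g : AltIso R N) :
    (g.perp (AltIso.psi R 1)).pullback (planeEquiv R N) = g.perp (AltIso.psi2 R) := by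
  rw [planeEquiv, ← AltIso.pullback_pullback, perp_psi_pullback_consEquiv]
  ext1
  apply LinearMap.ext
  intro x
  apply LinearMap.ext
  intro y
  have h0 : ∀ z t, psiForm R 0 z t = 0 := fun z t => by
    rw [psiForm_apply]
    rfl
  simp only [AltIso.pullback_apply, AltIso.perp_apply, AltIso.psi, h0, add_zero]
  rfl

/-- Planes are stripped one at a time until one is left. The rank on the large module is 2n + 4,
hence the Pfaffian of degree n + 2. Going from index n + 1 to n uses `htr n`; the case `htr 0`
concerns P₀ ⊕ R³. -/
lemma exists_on_plane (g : AltIso R P₀) (hr : Module.rankAtStalk (R := R) P₀ = 2)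
    (htr : ∀ n, ActsTransitivelyOnUm (SL R ((P₀ × (Fin (2 * (n + 1)) → R)) × R))) (n : ℕ)
    (f : AltIso R (P₀ × (Fin (2 * (n + 1)) → R)))
    (hf : f.pf (n + 2) = (g.perp (AltIso.psi R (n + 1))).pf (n + 2)) :
    ∃ f' : AltIso R (P₀ × (R × R)), f'.pf 2 = (g.perp (AltIso.psi2 R)).pf 2 ∧
      VSL.mk (P₀ × (Fin (2 * (n + 1)) → R)) (g.perp (AltIso.psi R (n + 1))) f
        = VSL.mk (P₀ × (R × R)) (g.perp (AltIso.psi2 R)) f' := by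
  induction n with
  | zero =>
    refine ⟨f.pullback (planeEquiv R P₀), ?_, ?_⟩
    · rw [← perp_psi_pullback_planeEquiv, AltIso.pf_pullback_eq_iff]
      exact hf
    · rw [← perp_psi_pullback_planeEquiv, VSL.mk_congr]
  | succ n ih =>
    have hr' : Module.rankAtStalk (R := R) (P₀ × (Fin (2 * (n + 1)) → R))
        = (2 * (n + 2) : ℕ) := by
      rw [rank_add (k := 2) hr (rank_free _)]
      congr 1
      ring
    obtain ⟨f', hf', hff'⟩ := exists_descend hr' (htr n) (g.perp (AltIso.psi R (n + 1)))
      (f.pullback (consEquiv R P₀ (n + 1))) (by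
        rw [← perp_psi_pullback_consEquiv, AltIso.pf_pullback_eq_iff]
        exact hf)
    obtain ⟨f'', hf'', h⟩ := ih f' hf'
    refine ⟨f'', hf'', ?_⟩
    rw [← h, ← hff', ← perp_psi_pullback_consEquiv, VSL.mk_congr]

/-- Alternating forms on a projective module of rank two are multiples of a non-degenerate one. -/
lemma exists_eq_smul (hr : Module.rankAtStalk (R := R) P₀ = 2) (θ₀ : R ≃ₗ[R] ⋀[R]^2 P₀)
    {B : P₀ →ₗ[R] P₀ →ₗ[R] R} (hB : ∀ p, B p p = 0) : ∃ c : R, B = c • chiForm θ₀ := by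
  -- The ideal consists of the r for which r·B is a multiple of χ₀. It contains each χ₀(x, y), since
  -- χ₀(x, y)·B = B(x, y)·χ₀ by the three-term identities for χ₀ and for B; so it contains 1.
  have h := chiForm_unimodular θ₀ (Submodule.comap (LinearMap.toSpanSingleton R _ B)
    (LinearMap.range (LinearMap.toSpanSingleton R _ (chiForm θ₀)))) (fun x y => by
      refine ⟨B x y, ?_⟩
      apply LinearMap.ext
      intro p
      apply LinearMap.ext
      intro q
      have h1 := congrArg (fun z => B z q) (threeTerm hr (chiForm_alt θ₀) x y p)
      have h2 := congrArg (chiForm θ₀ p) (threeTerm hr hB x y q)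
      simp only [map_add, map_sub, map_smul, LinearMap.add_apply, LinearMap.sub_apply,
        LinearMap.smul_apply, smul_eq_mul, map_zero, LinearMap.zero_apply] at h1 h2
      rw [alt_swap (chiForm_alt θ₀) x p, alt_swap (chiForm_alt θ₀) y p] at h2
      simp only [LinearMap.toSpanSingleton_apply, LinearMap.smul_apply, smul_eq_mul]
      linear_combination h2 - h1)
  obtain ⟨c, hc⟩ := h
  refine ⟨c, ?_⟩
  simpa using hc.symm

/-- Alternating forms on `P₀ ⊕ R` are contractions of the volume form. -/
lemma exists_eq_vol (hr : Module.rankAtStalk (R := R) P₀ = 2) (θ₀ : R ≃ₗ[R] ⋀[R]^2 P₀)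
    {B : P₀ × R →ₗ[R] P₀ × R →ₗ[R] R} (hB : ∀ p, B p p = 0) :
    ∃ w, ∀ x y, B x y = vol θ₀ x y w := by
  obtain ⟨c, hc⟩ := exists_eq_smul hr θ₀
    (B := B.compl₁₂ (LinearMap.inl R P₀ R) (LinearMap.inl R P₀ R)) (fun p => hB _)
  -- The last coordinate c of w comes from B on P₀; the component p represents, through χ₀, the
  -- pairing with (0, 1).
  obtain ⟨p, hp⟩ := (chi0 hr θ₀).bij.2 (B.flip (0, 1) ∘ₗ LinearMap.inl R P₀ R)
  refine ⟨(p, c), fun x y => ?_⟩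
  have h1 : B (x.1, 0) (y.1, 0) = c * chiForm θ₀ x.1 y.1 :=
    LinearMap.congr_fun (LinearMap.congr_fun hc x.1) y.1
  have h2 : ∀ q, B (q, 0) (0, 1) = chiForm θ₀ p q := fun q => (LinearMap.congr_fun hp q).symm
  have h3 : ∀ z : P₀ × R, z = (z.1, 0) + z.2 • (0, 1) := fun z => by simp
  have h4 : B x y = B (x.1, 0) (y.1, 0) + y.2 * B (x.1, 0) (0, 1) - x.2 * B (y.1, 0) (0, 1) := by
    conv_lhs => rw [h3 x, h3 y]
    simp only [map_add, map_smul, LinearMap.add_apply, LinearMap.smul_apply, smul_eq_mul, hB,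
      alt_swap hB (y.1, 0) (0, 1)]
    ring
  rw [h4, h1, h2, h2, vol, alt_swap (chiForm_alt θ₀) p x.1, alt_swap (chiForm_alt θ₀) p y.1]
  ring

lemma AltIso.pf_two {P : Type*} [AddCommGroup P] [Module R P] (g : AltIso R P) (x y z t : P) :
    g.pf 2 ![x, y, z, t]
      = g.form x y * g.form z t - g.form x z * g.form y t + g.form x t * g.form y z := by
  refine (pfMap_cons_four g.form g.alt (n := 0) _ _ _ _ _ (fun i => i.elim0)
    (fun i => i.elim0) (fun i => i.elim0)).trans ?_
  rw [pfMap_zero, mul_one]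

/-- A form on `P₀ ⊕ R²` with the Pfaffian of `χ₀ ⊥ ψ₂` is a form `V(a, s)`. -/
lemma exists_eq_symbolForm (hr : Module.rankAtStalk (R := R) P₀ = 2) (θ₀ : R ≃ₗ[R] ⋀[R]^2 P₀)
    (f : AltIso R (P₀ × (R × R)))
    (hf : f.pf 2 = ((chi0 hr θ₀).perp (AltIso.psi2 R)).pf 2) :
    ∃ (a : Um R (P₀ × R)) (s : P₀ × R) (hs : a.1 s = 1), f = symbolForm hr θ₀ a s hs := by
  let j : P₀ × R →ₗ[R] P₀ × (R × R) := LinearMap.prodMap LinearMap.id (LinearMap.inl R R R)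
  let e₄ : P₀ × (R × R) := (0, (0, 1))
  let a : P₀ × R →ₗ[R] R := f.form.flip e₄ ∘ₗ j
  have ha : ∀ x, f.form (j x) e₄ = a x := fun x => rfl
  obtain ⟨w, hw⟩ := exists_eq_vol hr θ₀ (B := f.form.compl₁₂ j j) (fun p => f.alt _)
  have hw' : ∀ x y, f.form (j x) (j y) = vol θ₀ x y w := hw
  have haw : a w = 1 := by
    -- On (p, q, (0, 1), e₄) the Pfaffian of `f` is χ₀(p, q)·a(w), by `a` applied to the four-term
    -- identity, while that of χ₀ ⊥ ψ₂ is χ₀(p, q). Hence a(w) - 1 is annihilated by all values of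
    -- χ₀, and these generate the unit ideal.
    have h1 := chiForm_unimodular θ₀
      (LinearMap.ker (LinearMap.toSpanSingleton R R (a w - 1))) (fun p q => by
        have h3 := DFunLike.congr_fun hf ![j (p, 0), j (q, 0), j (0, 1), e₄]
        rw [AltIso.pf_two, AltIso.pf_two] at h3
        have h4 := congrArg a (vol_fourTerm hr θ₀ (p, 0) (q, 0) (0, 1) w)
        simp only [map_add, map_sub, map_smul, smul_eq_mul, map_zero] at h4
        have h5 : vol θ₀ (p, 0) (q, 0) (0, 1) = chiForm θ₀ p q := by simp [vol]
        have h6 : ((chi0 hr θ₀).perp (AltIso.psi2 R)).form (j (p, 0)) (j (q, 0))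
              * ((chi0 hr θ₀).perp (AltIso.psi2 R)).form (j (0, 1)) e₄
              - ((chi0 hr θ₀).perp (AltIso.psi2 R)).form (j (p, 0)) (j (0, 1))
              * ((chi0 hr θ₀).perp (AltIso.psi2 R)).form (j (q, 0)) e₄
              + ((chi0 hr θ₀).perp (AltIso.psi2 R)).form (j (p, 0)) e₄
              * ((chi0 hr θ₀).perp (AltIso.psi2 R)).form (j (q, 0)) (j (0, 1))
            = chiForm θ₀ p q := by
          simp [j, e₄, chi0]
        rw [h6] at h3
        simp only [hw', ha] at h3
        rw [LinearMap.mem_ker, LinearMap.toSpanSingleton_apply, smul_eq_mul]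
        rw [h5] at h4
        linear_combination h3 + h4)
    simpa [sub_eq_zero] using h1
  have hsurj : Function.Surjective a := fun c =>
    ⟨c • w, by rw [map_smul, haw, smul_eq_mul, mul_one]⟩
  refine ⟨⟨a, hsurj⟩, w, haw, ?_⟩
  ext1
  apply LinearMap.ext
  intro x
  apply LinearMap.ext
  intro y
  have hd : ∀ z : P₀ × (R × R), z = j (z.1, z.2.1) + z.2.2 • e₄ := fun z => by simp [j, e₄]
  refine Eq.trans ?_ (symbolForm_apply hr θ₀ ⟨a, hsurj⟩ w haw x y).symm
  conv_lhs => rw [hd x, hd y]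
  simp only [map_add, map_smul, LinearMap.add_apply, LinearMap.smul_apply, smul_eq_mul, f.alt,
    hw', ha, alt_swap f.alt (j (y.1, y.2.1)) e₄]
  ring

end Surjective

/-! ### Embedding forms into hyperbolic forms -/

section Complement

variable {R : Type u} [CommRing R]

/-- An alternating form on a finite projective module is the antisymmetrization of a bilinear
form. -/
lemma exists_antisymmetrization {P : Type*} [AddCommGroup P] [Module R P] [Module.Finite R P]
    [Module.Projective R P] {B : P →ₗ[R] P →ₗ[R] R} (hB : ∀ p, B p p = 0) :
    ∃ (k : ℕ) (i : P →ₗ[R] Fin k → R) (x : Fin k → P) (α : P →ₗ[R] P →ₗ[R] R),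
      (∀ p, p = ∑ a, i p a • x a) ∧ ∀ p q, B p q = α p q - α q p := by
  obtain ⟨k, π, i, -, -, hπi⟩ := Module.Finite.exists_comp_eq_id_of_projective R P
  let x : Fin k → P := fun a => π (Pi.single a 1)
  let A : Matrix (Fin k) (Fin k) R := Matrix.of fun a b => B (x a) (x b)
  -- `P` is a retract of Rᵏ; the strictly upper triangular part of the Gram matrix of the images of
  -- the basis satisfies A = U - Uᵗ.
  let U : Matrix (Fin k) (Fin k) R := Matrix.of fun a b => if a < b then A a b else 0
  have hp : ∀ p, p = ∑ a, i p a • x a := fun p => by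
    conv_lhs => rw [← LinearMap.id_apply (R := R) p, ← hπi, LinearMap.comp_apply,
      pi_eq_sum_univ' (i p), map_sum]
    refine Finset.sum_congr rfl fun a _ => ?_
    rw [← map_smul]
  refine ⟨k, i, x, (Matrix.toLinearMap₂' R U).compl₁₂ i i, hp, fun p q => ?_⟩
  have hU : ∀ a b, A a b = U a b - U b a := fun a b => by
    simp only [U, Matrix.of_apply]
    rcases lt_trichotomy a b with h | rfl | h
    · simp [h, h.not_gt]
    · simp [A, hB]
    · simp only [h, h.not_gt, if_true, if_false, zero_sub]
      exact alt_swap hB _ _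
  simp only [LinearMap.compl₁₂_apply, Matrix.toLinearMap₂'_apply]
  rw [Finset.sum_comm (f := fun a b => i q a • i p b • U a b), ← Finset.sum_sub_distrib]
  conv_lhs => rw [hp p, hp q]
  simp only [map_sum, LinearMap.sum_apply, map_smul, LinearMap.smul_apply, smul_eq_mul]
  simp only [Finset.mul_sum]
  rw [Finset.sum_comm]
  refine Finset.sum_congr rfl fun a _ => ?_
  rw [← Finset.sum_sub_distrib]
  refine Finset.sum_congr rfl fun b _ => ?_
  have := hU a b
  simp only [A, Matrix.of_apply] at this
  rw [this]
  ring

/-- Interleaving the coordinates of two vectors. -/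
def interleave (R : Type*) [CommRing R] (k : ℕ) :
    (Fin k → R) × (Fin k → R) →ₗ[R] Fin (2 * k) → R where
  toFun x i := if Even (i : ℕ) then x.1 ⟨i / 2, by omega⟩ else x.2 ⟨i / 2, by omega⟩
  map_add' x y := by
    ext i
    by_cases h : Even (i : ℕ) <;> simp [h]
  map_smul' c x := by
    ext i
    by_cases h : Even (i : ℕ) <;> simp [h]

lemma psi_interleave (k : ℕ) (x y : (Fin k → R) × (Fin k → R)) :
    (AltIso.psi R k).form (interleave R k x) (interleave R k y)
      = ∑ j, (x.1 j * y.2 j - x.2 j * y.1 j) := by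
  induction k with
  | zero =>
    change psiForm R 0 _ _ = _
    rw [psiForm_apply]
    rfl
  | succ k ih =>
    rw [psi_form_succ, Fin.sum_univ_succ]
    have h0 : ∀ z, interleave R (k + 1) z (0 : Fin (2 * k + 2)) = z.1 0 := fun z => by
      simp [interleave]
    have h1 : ∀ z, interleave R (k + 1) z (1 : Fin (2 * k + 2)) = z.2 0 := fun z => by
      simp [interleave, Nat.mod_eq_of_lt (show 1 < 2 * (k + 1) by omega)]
    have h2 : ∀ z : (Fin (k + 1) → R) × (Fin (k + 1) → R),
        (fun i : Fin (2 * k) => interleave R (k + 1) z (i.succ.succ : Fin (2 * k + 2)))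
          = interleave R k (fun j => z.1 j.succ, fun j => z.2 j.succ) := fun z => by
      funext i
      have : ((i : ℕ) + 1 + 1) / 2 = i / 2 + 1 := by omega
      simp [interleave, Nat.even_add_one, this]
    rw [h0, h0, h1, h1, h2, h2, ih]

/-- Every alternating form on a finite projective module is induced from some `ψ₂ₖ`. -/
lemma exists_isometric_map {P : Type*} [AddCommGroup P] [Module R P] [Module.Finite R P]
    [Module.Projective R P] {B : P →ₗ[R] P →ₗ[R] R} (hB : ∀ p, B p p = 0) :
    ∃ (k : ℕ) (ι : P →ₗ[R] Fin (2 * k) → R), ∀ p q, (AltIso.psi R k).form (ι p) (ι q) = B p q := by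
  obtain ⟨k, i, x, α, hx, hα⟩ := exists_antisymmetrization hB
  let β : P →ₗ[R] Fin k → R :=
    LinearMap.pi fun j => α.flip (x j)
  -- The map is p ↦ (p, -α(p, ·)) into the hyperbolic form on Rᵏ ⊕ Rᵏ, where it induces α(p, q) -
  -- α(q, p) = B(p, q).
  refine ⟨k, interleave R k ∘ₗ (i.prod (-β)), fun p q => ?_⟩
  have hβ : ∀ p q, ∑ j, i p j * β q j = α q p := fun p q => by
    conv_rhs => rw [hx p, map_sum]
    simp [β]
  rw [LinearMap.comp_apply, LinearMap.comp_apply, psi_interleave, hα, ← hβ, ← hβ,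
    Finset.sum_sub_distrib]
  simp [mul_comm]
  abel

/-- A non-degenerate subspace has an orthogonal complement. -/
lemma exists_orthogonal_complement {P W : Type*} [AddCommGroup P] [Module R P] [AddCommGroup W]
    [Module R W] (ω : AltIso R W) (g : AltIso R P) (ι : P →ₗ[R] W)
    (hι : ∀ p q, ω.form (ι p) (ι q) = g.form p q) :
    ∃ (N : Submodule R W) (h : AltIso R N) (e : W ≃ₗ[R] P × N), ω = (g.perp h).pullback e := by
  let G : P ≃ₗ[R] (P →ₗ[R] R) := LinearEquiv.ofBijective g.form g.bij
  -- `ρ` is the adjoint of `ι`, which exists because `g` is non-degenerate. It retracts `ι`, and its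
  -- kernel is the orthogonal complement of the image.
  let ρ : W →ₗ[R] P := G.symm.toLinearMap ∘ₗ ω.form.compl₂ ι
  have hρ : ∀ w p, g.form (ρ w) p = ω.form w (ι p) := fun w p =>
    LinearMap.congr_fun (G.apply_symm_apply (ω.form.compl₂ ι w)) p
  have hρι : ∀ p, ρ (ι p) = p := fun p => g.bij.1 (LinearMap.ext fun q => by rw [hρ, hι])
  let e : W ≃ₗ[R] P × LinearMap.ker ρ :=
    LinearEquiv.ofLinearMap
      (ρ.prod ((LinearMap.id - ι ∘ₗ ρ).codRestrict (LinearMap.ker ρ) fun w => by simp [hρι]))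
      (ι.coprod (LinearMap.ker ρ).subtype)
      (by
        ext x
        · simp [hρι]
        · simp [hρι]
        · simp
        · simp)
      (by ext w; simp)
  have he : ∀ y : P × LinearMap.ker ρ, e.symm y = ι y.1 + y.2 := fun y => rfl
  have h0 : ∀ p (n : LinearMap.ker ρ), ω.form (ι p) n = 0 := fun p n => by
    have hn : ρ n = 0 := n.2
    rw [alt_swap ω.alt, ← hρ, hn, map_zero, LinearMap.zero_apply, neg_zero]
  -- The factors are swapped because `ofPerp` restricts to the first one.
  let F := (ω.pullback e.symm).pullback (LinearEquiv.prodComm R (LinearMap.ker ρ) P)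
  have hF : ∀ x y, F.form x y = ω.form (ι x.2 + x.1) (ι y.2 + y.1) := fun x y => rfl
  refine ⟨LinearMap.ker ρ, F.ofPerp (fun n p => ?_), e, ?_⟩
  · rw [hF]
    simp [alt_swap ω.alt (ι p) n, h0]
  · have : ω.pullback e.symm = g.perp (F.ofPerp (fun n p => by
        rw [hF]
        simp [alt_swap ω.alt (ι p) n, h0])) := by
      ext1
      apply LinearMap.ext
      intro x
      apply LinearMap.ext
      intro y
      have h1 : (F.ofPerp (fun n p => by
        rw [hF]
        simp [alt_swap ω.alt (ι p) n, h0])).form x.2 y.2 = F.form (x.2, 0) (y.2, 0) := rfl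
      rw [AltIso.pullback_apply, AltIso.perp_apply, he, he, h1, hF]
      simp only [map_add, LinearMap.add_apply, h0, hι, map_zero, zero_add, add_zero,
        alt_swap ω.alt (ι y.1) x.2, neg_zero]
    rw [← this, AltIso.pullback_pullback]
    ext x y
    simp

end Complement

/-! ### The image of the generalized Vaserstein symbol -/

section Image

variable {R : Type u} [CommRing R]

lemma psiForm_single_single (n : ℕ) (i j : Fin (2 * n)) :
    psiForm R n (Pi.single i 1) (Pi.single j 1) = psiMatrix R n i j := by
  rw [← partner_partner n j, psiForm_single, psiMatrix_apply, psiSign, partner_partner]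
  by_cases h : i = partner n j
  · simp [h, partner_partner]
  · have h' : j ≠ partner n i := fun h' => h (by rw [h', partner_partner])
    rw [Pi.single_eq_of_ne (Ne.symm h), mul_zero, if_neg h']

lemma AltIso.pf_psi (n : ℕ) : (AltIso.psi R n).pf n (fun i => Pi.single i 1) = 1 := by
  refine (pfMap_eq_pfaffian _ _ _ _).trans (Eq.trans ?_ (pfaffian_psiMatrix R n))
  congr 1
  ext i j
  exact psiForm_single_single n i j

lemma AltIso.pf_single (n : ℕ) (M : AltIso R (Fin (2 * n) → R)) :
    M.pf n (fun i => Pi.single i 1) = pfaffian n M.gram :=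
  pfMap_eq_pfaffian _ _ _ _

variable {P₀ : Type u} [AddCommGroup P₀] [Module R P₀] [Module.Finite R P₀]
  [Module.Projective R P₀]

/-- Local generators of P₀ and of `N` combine to generators of the sum, in an order that lets the
Pfaffian be expanded along P₀ first. -/
lemma exists_local_pair (hr : Module.rankAtStalk (R := R) P₀ = 2) {N : Type*} [AddCommGroup N]
    [Module R N] {k : ℕ} (v : Fin k → N) (m : PrimeSpectrum R)
    (hv : ∀ x, ∃ t ∉ m.asIdeal, ∃ c : Fin k → R, t • x = ∑ j, c j • v j) :
    ∃ e₀ e₁ : P₀, ∀ x : P₀ × N, ∃ t ∉ m.asIdeal, ∃ c : Fin (k + 2) → R,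
      t • x = ∑ j, c j • (Fin.cons (e₀, 0) (Fin.cons (e₁, 0) (fun i => (0, v i)) :
        Fin (k + 1) → P₀ × N) : Fin (k + 2) → P₀ × N) j := by
  obtain ⟨e₀, e₁, he⟩ := localGenerators hr m
  refine ⟨e₀, e₁, fun x => ?_⟩
  obtain ⟨t, ht, a, b, hp⟩ := he x.1
  obtain ⟨t', ht', c, hn⟩ := hv x.2
  refine ⟨t * t', m.asIdeal.primeCompl.mul_mem ht ht',
    Fin.cons (t' * a) (Fin.cons (t' * b) (fun j => t * c j) : Fin (k + 1) → R), ?_⟩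
  rw [Fin.sum_univ_succ, Fin.sum_univ_succ]
  simp only [Fin.cons_zero, Fin.cons_succ]
  ext1
  · simp only [Prod.smul_fst, Prod.fst_add, Prod.fst_sum, smul_zero, Finset.sum_const_zero,
      add_zero]
    rw [mul_comm, mul_smul, hp, smul_add, smul_smul, smul_smul]
  · simp only [Prod.smul_snd, Prod.snd_add, Prod.snd_sum, smul_zero, zero_add]
    rw [mul_smul, hn, Finset.smul_sum]
    simp only [smul_smul]

/-- If `M` has Pfaffian `1`, then `g ⊥ M` and `g ⊥ ψ₂ₙ` have the same Pfaffian. -/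
lemma pf_perp_matrix (hr : Module.rankAtStalk (R := R) P₀ = 2) (g : AltIso R P₀) {n : ℕ}
    (M : AltIso R (Fin (2 * n) → R)) (hM : pfaffian n M.gram = 1) :
    (g.perp M).pf (n + 1) = (g.perp (AltIso.psi R n)).pf (n + 1) := by
  refine alternating_ext_of_local (k := 2 * n + 2) _ _ fun m => ?_
  obtain ⟨e₀, e₁, he⟩ := exists_local_pair hr (fun i : Fin (2 * n) => Pi.single i (1 : R)) m
    (fun x => ⟨1, fun h => m.2.ne_top ((Ideal.eq_top_iff_one _).2 h), x, by
      rw [one_smul]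
      exact pi_eq_sum_univ' x⟩)
  refine ⟨_, ⟨1, fun h => m.2.ne_top ((Ideal.eq_top_iff_one _).2 h), ?_⟩, he⟩
  -- The Pfaffian of the orthogonal sum is a product, so only the values of `M` and ψ₂ₙ on the
  -- standard basis matter, and both are 1.
  have key : ∀ F : AltIso R (Fin (2 * n) → R), (g.perp F).pf (n + 1)
      (Fin.cons (e₀, 0) (Fin.cons (e₁, 0) (fun i => (0, Pi.single i 1)) :
        Fin (2 * n + 1) → P₀ × (Fin (2 * n) → R)) : Fin (2 * n + 2) → P₀ × (Fin (2 * n) → R))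
        = g.form e₀ e₁ * F.pf n (fun i => Pi.single i 1) := fun F => by
    refine (pfMap_cons_cons _ _ _ _ _ (by simp)).trans ?_
    congr 1
    · simp
    · exact pfMap_comp _ _ _ _ _ _ fun i j => by simp
  rw [one_mul, one_mul]
  refine (key M).trans (Eq.trans ?_ (key (AltIso.psi R n)).symm)
  rw [AltIso.pf_single, hM, AltIso.pf_psi]

/-- Adding an orthogonal summand to forms on `P₀ ⊕ R²` with the same Pfaffian. -/
lemma pf_perp_eq (hr : Module.rankAtStalk (R := R) P₀ = 2) {f g : AltIso R (P₀ × (R × R))}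
    (hfg : ∀ p q, f.pf 2 ![(p, 0), (q, 0), (0, (1, 0)), (0, (0, 1))]
      = g.pf 2 ![(p, 0), (q, 0), (0, (1, 0)), (0, (0, 1))])
    {N : Type*} [AddCommGroup N] [Module R N] [Module.Finite R N] [Module.Projective R N] {n : ℕ}
    (hN : Module.rankAtStalk (R := R) N = (2 * n : ℕ))
    (h : AltIso R N) : (f.perp h).pf (n + 2) = (g.perp h).pf (n + 2) := by
  refine alternating_ext_of_local (k := 2 * n + 4) _ _ fun m => ?_
  obtain ⟨v, hv⟩ := exists_local_generators hN m
  obtain ⟨e₀, e₁, he⟩ := exists_local_pair hr (N := (R × R) × N)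
    (Fin.cons ((1, 0), 0) (Fin.cons ((0, 1), 0) (fun i => (0, v i)) :
      Fin (2 * n + 1) → (R × R) × N) : Fin (2 * n + 2) → (R × R) × N) m (fun x => by
    obtain ⟨t, ht, c, hc⟩ := hv x.2
    refine ⟨t, ht, Fin.cons (t * x.1.1) (Fin.cons (t * x.1.2) c : Fin (2 * n + 1) → R), ?_⟩
    rw [Fin.sum_univ_succ, Fin.sum_univ_succ]
    simp only [Fin.cons_zero, Fin.cons_succ]
    ext1
    · simp only [Prod.smul_fst, Prod.fst_add, Prod.fst_sum, smul_zero, Finset.sum_const_zero,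
        add_zero]
      ext <;> simp
    · simp [Prod.snd_sum, hc])
  let w : Fin (2 * n + 4) → (P₀ × (R × R)) × N :=
    Fin.cons ((e₀, 0), 0) (Fin.cons ((e₁, 0), 0) (Fin.cons ((0, (1, 0)), 0)
      (Fin.cons ((0, (0, 1)), 0) (fun i => (0, v i)) : Fin (2 * n + 1) → (P₀ × (R × R)) × N)
      : Fin (2 * n + 2) → (P₀ × (R × R)) × N) : Fin (2 * n + 3) → (P₀ × (R × R)) × N)
  refine ⟨w, ⟨1, fun h => m.2.ne_top ((Ideal.eq_top_iff_one _).2 h), ?_⟩, fun x => ?_⟩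
  · have key : ∀ F : AltIso R (P₀ × (R × R)), (F.perp h).pf (n + 2) w
        = F.pf 2 ![(e₀, 0), (e₁, 0), (0, (1, 0)), (0, (0, 1))] * h.pf n v := fun F => by
      refine (pfMap_cons_four _ _ _ _ _ _ _ (by simp) (by simp) (by simp)).trans ?_
      rw [AltIso.pf_two]
      congr 1
      · simp
      · exact pfMap_comp _ _ _ _ _ _ fun i j => by simp
    rw [one_mul, one_mul]
    refine (key f).trans (Eq.trans ?_ (key g).symm)
    rw [hfg]
  · obtain ⟨t, ht, c, hc⟩ := he (x.1.1, (x.1.2, x.2))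
    refine ⟨t, ht, c, ?_⟩
    have h2 := congrArg (LinearEquiv.prodAssoc R P₀ (R × R) N).symm hc
    rw [map_sum] at h2
    refine Eq.trans ?_ (h2.trans (Finset.sum_congr rfl fun j _ => ?_))
    · rfl
    · rw [map_smul]
      congr 1
      revert j
      change ∀ j : Fin (2 * n + 4), _
      intro j
      exact Fin.cases (fun _ => rfl) (fun j => Fin.cases (fun _ => rfl) (fun j =>
        Fin.cases (fun _ => rfl) (fun j => Fin.cases (fun _ => rfl) (fun j _ => rfl) j) j) j) j

/-- Applying `a` to the four-term identity for (p, 0), (q, 0), (0, 1), s gives χ₀(p, q)·a(s) for the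
left-hand side, and a(s) = 1. Such quadruples suffice for `pf_perp_eq`. -/
lemma pf_symbolForm (hr : Module.rankAtStalk (R := R) P₀ = 2) (θ₀ : R ≃ₗ[R] ⋀[R]^2 P₀)
    (a : Um R (P₀ × R)) (s : P₀ × R) (hs : a.1 s = 1) (p q : P₀) :
    (symbolForm hr θ₀ a s hs).pf 2 ![(p, 0), (q, 0), (0, (1, 0)), (0, (0, 1))]
      = ((chi0 hr θ₀).perp (AltIso.psi2 R)).pf 2 ![(p, 0), (q, 0), (0, (1, 0)), (0, (0, 1))] := by
  rw [AltIso.pf_two, AltIso.pf_two]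
  have h1 := congrArg a.1 (vol_fourTerm hr θ₀ (p, 0) (q, 0) (0, 1) s)
  have h2 : vol θ₀ (p, 0) (q, 0) (0, 1) = chiForm θ₀ p q := by simp [vol]
  have h3 : ((chi0 hr θ₀).perp (AltIso.psi2 R)).form (p, 0) (q, 0) = chiForm θ₀ p q := by
    simp [chi0]
  have h0 : a.1 ((0 : P₀), (0 : R)) = 0 := map_zero a.1
  have h4 : ∀ x, vol θ₀ x ((0 : P₀), (0 : R)) s = 0 := fun x => by
    simp only [vol, map_zero, LinearMap.zero_apply]
    ring
  simp only [map_add, map_sub, map_smul, smul_eq_mul, map_zero, hs, h2] at h1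
  rw [h3]
  simp only [symbolForm_apply, AltIso.perp_apply, AltIso.psi2_apply, Prod.fst_zero, Prod.snd_zero,
    map_zero, LinearMap.zero_apply, h0, h4]
  linear_combination -h1

/-- A complement (N, h) of χ₀ ⊥ ψ₂ in ψ₂ₖ is added to both forms. The base form becomes ψ₂ₖ, and the
other one keeps the same Pfaffian, namely 1. -/
lemma symbolClass_mem_tildeVSL (hr : Module.rankAtStalk (R := R) P₀ = 2)
    (θ₀ : R ≃ₗ[R] ⋀[R]^2 P₀) (a : Um R (P₀ × R)) (s : P₀ × R) (hs : a.1 s = 1) :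
    symbolClass hr θ₀ a s hs ∈ tildeVSL R := by
  set g := (chi0 hr θ₀).perp (AltIso.psi2 R) with hg
  obtain ⟨k, ι, hι⟩ := exists_isometric_map g.alt
  obtain ⟨N, h, e, he⟩ := exists_orthogonal_complement (AltIso.psi R k) g ι hι
  have : Module.Finite R N := Module.Finite.of_surjective
    (LinearMap.snd R (P₀ × (R × R)) N ∘ₗ e.toLinearMap)
    (Prod.snd_surjective.comp e.surjective)
  have : Module.Projective R N := Module.Projective.of_split
    (e.symm.toLinearMap ∘ₗ LinearMap.inr R (P₀ × (R × R)) N)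
    (LinearMap.snd R (P₀ × (R × R)) N ∘ₗ e.toLinearMap) (by ext x; simp)
  refine ⟨k, ((symbolForm hr θ₀ a s hs).perp h).pullback e, ?_, ?_⟩
  -- Over the zero ring there is no prime at which to read off ranks, but there every equation in R
  -- holds.
  · rcases subsingleton_or_nontrivial R with hR | hR
    · exact Subsingleton.elim _ _
    · have hk : ∀ p, 2 * k = 4 + Module.rankAtStalk (R := R) N p := fun p => by
        have h1 := congrFun (Module.rankAtStalk_eq_of_equiv e) p
        have h2 : Module.rankAtStalk (R := R) (P₀ × (R × R)) = (4 : ℕ) :=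
          rank_add (k := 2) hr rank_plane
        rw [rank_free, Module.rankAtStalk_prod, h2] at h1
        exact h1
      obtain ⟨p⟩ : Nonempty (PrimeSpectrum R) := inferInstance
      -- The rank 4 of P₀ ⊕ R² fits into 2k at any prime, so k ≥ 2 and `N` has constant rank 2k - 4.
      obtain ⟨n, rfl⟩ : ∃ n, k = n + 2 := ⟨k - 2, by have := hk p; omega⟩
      have hN : Module.rankAtStalk (R := R) N = (2 * n : ℕ) := by
        funext p
        have := hk p
        simp only [Pi.natCast_apply, Nat.cast_id]
        omega
      have h3 := pf_perp_eq hr (pf_symbolForm hr θ₀ a s hs) hN h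
      rw [← AltIso.pf_pullback_eq_iff e, ← hg, ← he] at h3
      rw [← AltIso.pf_single, h3, AltIso.pf_psi]
  · rw [he, VSL.mk_congr, VSL.mk_perp_self]
    rfl

/-- The values of χ₀ generate the unit ideal, so the forms χ₀(p, ·) cannot all map into a prime. -/
lemma hasLocalForms_of_rank_two (θ₀ : R ≃ₗ[R] ⋀[R]^2 P₀) : HasLocalForms R P₀ := by
  intro q hq
  by_contra! h
  exact hq.ne_top ((Ideal.eq_top_iff_one _).2
    (chiForm_unimodular θ₀ q fun p p' => h (chiForm θ₀ p) p'))

/-- For index 0 this is the hypothesis on P₅. From index 1 on, P₀ ⊕ R⁴ already raises heights to 5,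
one more than the dimension bound. -/
lemma transitive_of_dim_le_four [IsNoetherianRing R] (hdim : ringKrullDim R ≤ 4)
    (θ₀ : R ≃ₗ[R] ⋀[R]^2 P₀)
    (htrans : ActsTransitivelyOnUm (SL R (P₀ × (Fin 3 → R)))) (n : ℕ) :
    ActsTransitivelyOnUm (SL R ((P₀ × (Fin (2 * (n + 1)) → R)) × R)) := by
  rcases n with _ | n
  · exact htrans.congr (snocEquiv R P₀ 2).symm
  · exact actsTransitively_of_canRaiseHeight (d := 4) hdim
      ((canRaiseHeight_free (hasLocalForms_of_rank_two θ₀) _).mono (by omega))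

/-- Add χ₀ to both forms, strip planes down to P₀ ⊕ R², and recognize the remaining form as some
V(a, s). -/
lemma mem_range_of_mem_tildeVSL (hr : Module.rankAtStalk (R := R) P₀ = 2)
    (θ₀ : R ≃ₗ[R] ⋀[R]^2 P₀)
    (htr : ∀ n, ActsTransitivelyOnUm (SL R ((P₀ × (Fin (2 * (n + 1)) → R)) × R))) {x : VSL R}
    (hx : x ∈ tildeVSL R) : x ∈ Set.range (vasersteinSymbol hr θ₀) := by
  obtain ⟨n, M, hM, rfl⟩ := hx
  obtain ⟨f, hf, hfx⟩ : ∃ f : AltIso R (P₀ × (R × R)),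
      f.pf 2 = ((chi0 hr θ₀).perp (AltIso.psi2 R)).pf 2 ∧
      VSL.mk (Fin (2 * n) → R) (AltIso.psi R n) M
        = VSL.mk (P₀ × (R × R)) ((chi0 hr θ₀).perp (AltIso.psi2 R)) f := by
    rcases n with _ | n
    -- For size 0 the class is zero, and so is that of χ₀ ⊥ ψ₂ against itself.
    · refine ⟨_, rfl, ?_⟩
      have : M = AltIso.psi R 0 := by
        ext1
        apply LinearMap.ext
        intro x
        have hx : x = 0 := funext fun i => i.elim0
        rw [hx, map_zero, map_zero]
      rw [this, VSL.mk_self, VSL.mk_self]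
    · obtain ⟨f, hf, h⟩ := exists_on_plane (chi0 hr θ₀) hr htr n ((chi0 hr θ₀).perp M)
        (pf_perp_matrix hr _ M hM)
      refine ⟨f, hf, ?_⟩
      rw [← h, VSL.mk_perp, VSL.mk_self, zero_add]
  obtain ⟨a, s, hs, rfl⟩ := exists_eq_symbolForm hr θ₀ f hf
  exact ⟨Quotient.mk _ a, (symbolUm_eq hr θ₀ a s hs).trans hfx.symm⟩

end Image

end GenVaserstein

end

theorem theorem3p2 {R : Type u} [CommRing R] [IsNoetherianRing R] (hdim : ringKrullDim R ≤ 4)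
    {P₀ : Type u} [AddCommGroup P₀] [Module R P₀] [Module.Finite R P₀] [Module.Projective R P₀]
    (hrank : Module.rankAtStalk (R := R) P₀ = 2) (θ₀ : R ≃ₗ[R] ⋀[R]^2 P₀)
    (htrans : GenVaserstein.ActsTransitivelyOnUm (GenVaserstein.SL R (P₀ × (Fin 3 → R)))) :
    Set.range (GenVaserstein.vasersteinSymbol hrank θ₀) = GenVaserstein.tildeVSL R := by
  apply Set.Subset.antisymm
  · rintro _ ⟨x, rfl⟩
    induction x using Quotient.inductionOn with | _ a =>
    exact GenVaserstein.symbolClass_mem_tildeVSL hrank θ₀ a _ (a.2 1).choose_spec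
  · intro x hx
    exact GenVaserstein.mem_range_of_mem_tildeVSL hrank θ₀
      (GenVaserstein.transitive_of_dim_le_four hdim θ₀ htrans) hx
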